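/- **Setting.** Let $N\ge 1$, $0<\varepsilon<1$, $z_1,\dots,z_N\in\mathbb C$ with $|z_j|\le 1$, $\hat f\in\mathbb C^N$, and $f:=C\hat f$ with $C=(z_j^{k})_{j,k=1,\dots,N}$, i.e. $f_j=\sum_{k=1}^N\hat f_k z_j^k$. One *flop* is one addition or multiplication of complex numbers (a bounded number of real floating point operations; arithmetic is exact). Only operations on data depending on $\hat f$ are counted; factors that depend only on $N,\varepsilon$ and the nodes are precomputed. **Chebyshev interpolation.** On $[a,b]$ let $t_r=\frac{a+b}2+\frac{b-a}2\cos\frac{(2r+1)\pi}{2q}$, $0\le r<q$, be the $q$ Chebyshev nodes and $L_r(t)=\prod_{j\ne r}\frac{t-t_j}{t_r-t_j}$ the Lagrange polynomials. **Algorithm.** Put $\xi_k=k$, $y_{\max}=\log\frac1\varepsilon$, $\xi_{\max}=N$, $$M=\max\Big(1,\Big\lceil\log_2\frac{N\log(1/\varepsilon)}{\varepsilon}\Big\rceil+1\Big),\qquad q=\Big\lceil\frac12+\log_4\frac1\varepsilon\Big\rceil .$$ Write $z_j=e^{-y_j}e^{2\pi i x_j}$ with $y_j\ge 0$, $x_j\in[0,1)$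 (for $z_j\neq0$; the polar form of $z_j=0$ is irrelevant, put $x_j=0$). Decompose $[0,y_{\max}]$ into $Y_M=[0,y_{\max}2^{1-M}]$ and $Y_m=(y_{\max}2^{-m},y_{\max}2^{1-m}]$, $1\le m<M$, and $[0,\xi_{\max}]$ likewise into $\Omega_1,\dots,\Omega_M$. For $1\le m<M$ let $$L_m=M-m,\qquad \ell_m=\max\big(1,\lfloor\log_2(y_{\max}\xi_{\max})-m-\log_2\log(1/\varepsilon)\rfloor+1\big).$$ Let $\tilde A$ be one of the two approximate Fourier transforms below, which approximates the multiplication with $A=(e^{2\pi i\xi_kx_j})_{j,k}$, called with tolerance $\delta=\varepsilon^2/16$; submatrices of it are applied by padding the input with zeros and restricting the output. The output $\tilde f$ is obtained as follows. 1. $\tilde f_j=0$ if $|z_j|<\varepsilon$. All other nodes belong to exactly one band $Z_m=\{z_j:|z_j|\ge\varepsilon,\ y_j\in Y_m\}$, $1\le m\le M$. 2. $\tilde f_j=(\tilde A\hat f)_j$ for $z_j\in Z_M$. 3. For $1\le\ell<M$, $\xi_k\in\Omega_\ell$, $0\le r<q$: $\hat F_{k,r}=\hat f_k L_r^{\Omega_\ell}(\xi_k)$.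 4. For $1\le m<M$ and $z_j\in Z_m$: $$\tilde f_j=\big(\tilde A\,\hat f|_{\bigcup_{\ell>L_m}\Omega_\ell}\big)_j+\sum_{s=0}^{q-1}L_s^{Y_m}(y_j)\,(\tilde A\,w^{(m,s)})_j,$$ where $w^{(m,s)}_k=\sum_{r=0}^{q-1}e^{-y_s^{Y_m}\xi_r^{\Omega_\ell}}\hat F_{k,r}$ if $\xi_k\in\Omega_\ell$ with $\ell_m\le\ell\le L_m$, and $w^{(m,s)}_k=0$ otherwise; here $y_s^{Y_m}$ and $\xi_r^{\Omega_\ell}$ are the Chebyshev nodes of (the closures of) $Y_m$ and $\Omega_\ell$. **Fourier transform (a): the NNFFT** (fast Fourier transform nonequispaced in time and frequency), with Gaussian windows. Let $\beta=\lceil\log\frac1\delta\rceil+10$, $\psi(t)=e^{-\pi t^2/\beta}$, $\hat\psi(\theta)=\sqrt\beta\,e^{-\pi\beta\theta^2}$, $P=2^{\lceil\log_2(4(N+\beta))\rceil}$, and $\theta_j=\frac12(x_j-\frac12)$. If $N\le\beta$, multiply directly with $A$. Otherwise, for an input vector $c$, compute * for integers $-\frac P2\le t<\frac P2$: $\ g_t=\hat\psi(t/P)^{-1}\sum_{k:\,|2\xi_k-N-t|\le\beta}\psi(2\xi_k-N-t)\,e^{\pi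 i\xi_k}c_k$; * $G_l=\sum_t g_t e^{2\pi i tl/P}$, $l\in\mathbb Z/P$, by a radix-2 FFT; * the output $\ \dfrac{e^{2\pi i\theta_jN}}{\hat\psi(\theta_j)}\sum_{l\in\mathbb Z:\,|P\theta_j-l|\le\beta}\psi(P\theta_j-l)\,G_{l\bmod P}$, $\ j=1,\dots,N$. **Fourier transform (b): the butterfly sparse Fourier transform.** Let $L=\lceil\log_2N\rceil$ and $p=2L+2\lceil\log\frac1\delta\rceil+20$. On level $l=0,\dots,L$ consider the spatial intervals $X_{l,i}=[i2^{-l},(i+1)2^{-l}]$, $0\le i<2^l$, with Chebyshev nodes $x^{l,i}_r$, $0\le r<p$, and Lagrange polynomials $L^{l,i}_r$, the frequency intervals $B_{l,b}=(b2^l,(b+1)2^l]$, $0\le b<2^{L-l}$, and the functions $\Lambda^{l,i,b}_s(x)=e^{2\pi i(b+\frac12)2^l(x-x_s^{l,i})}L_s^{l,i}(x)$ (where the $i$ preceding a parenthesis in the exponent is the imaginary unit). For an input vector $c$, compute $v^{0,0,b}_r=\sum_{\xi_k\in B_{0,b}}c_ke^{2\pi i\xi_kx_r^{0,0}}$, then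 for $l=0,\dots,L-1$ $$v^{l+1,i,b}_r=\sum_{b'\in\{2b,2b+1\}}\sum_{s=0}^{p-1}\Lambda_s^{l,\lfloor i/2\rfloor,b'}(x_r^{l+1,i})\,v_s^{l,\lfloor i/2\rfloor,b'},$$ and finally the output $\sum_{s}\Lambda_s^{L,i,0}(x_j)\,v_s^{L,i,0}$ with $i=\lfloor 2^Lx_j\rfloor$. **Theorem.** 1. (Accuracy.) For all $N\ge1$, $0<\varepsilon<1$, $z_j$ in the closed unit disk and $\hat f\in\mathbb C^N$, the output $\tilde f$ of the algorithm, with the NNFFT and with the butterfly sparse Fourier transform alike, satisfies $$\|f-\tilde f\|_\infty\le\varepsilon\|\hat f\|_1 .$$ 2. (Complexity.) For every $\varepsilon_0\in(0,1)$ there is a constant $\kappa$ depending only on $\varepsilon_0$ such that for all $0<\varepsilon\le\varepsilon_0$, all nodes $z_j$ in the closed unit disk and all $\hat f\in\mathbb C^N$, the algorithm takes at most $\kappa\,N\log\frac1\varepsilon\,\log^2\frac N\varepsilon$ flops with the NNFFT, for all $N\ge1$, and at most $\kappa\,N\log N\,\log\frac1\varepsilon\,\log^3\frac N\varepsilon$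 flops with the butterfly sparse Fourier transform, for all $N\ge2$. -/

import Mathlib

noncomputable section

namespace DiskEval

/-! ### Counting floating point operations -/

/-- A computation that returns `val` after performing `flops` arithmetic operations on
complex numbers. -/
structure Flops (α : Type) where
  val : α
  flops : ℕ

namespace Flops

instance : Monad Flops where
  pure a := ⟨a, 0⟩
  bind c g := ⟨(g c.val).val, c.flops + (g c.val).flops⟩

/-- One multiplication. -/
def mul (a b : ℂ) : Flops ℂ := ⟨a * b, 1⟩

/-- One addition. -/
def add (a b : ℂ) : Flops ℂ := ⟨a + b, 1⟩

/-- Run `c i` for each `i ∈ s` and accumulate the results, with one addition for each. -/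
def sum {ι : Type} (s : Finset ι) (c : ι → Flops ℂ) : Flops ℂ :=
  ⟨∑ i ∈ s, (c i).val, ∑ i ∈ s, ((c i).flops + 1)⟩

/-- Run `c i` for each `i ∈ s` and store the results in an array, padded by zeros. -/
def forEach {ι α : Type} [DecidableEq ι] [Zero α] (s : Finset ι) (c : ι → Flops α) :
    Flops (ι → α) :=
  ⟨fun i => if i ∈ s then (c i).val else 0, ∑ i ∈ s, (c i).flops⟩

/-- The linear combination `∑ i ∈ s, w i * v i`, by one multiplication and one addition for
each term. -/
def lincomb {ι : Type} (s : Finset ι) (w v : ι → ℂ) : Flops ℂ :=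
  sum s fun i => mul (w i) (v i)

end Flops

/-! ### Chebyshev interpolation -/

/-- The `j`-th of the `q` Chebyshev nodes of the interval `[a, b]`. -/
def chebNode (q : ℕ) (a b : ℝ) (j : Fin q) : ℝ :=
  (a + b) / 2 + (b - a) / 2 * Real.cos ((2 * (j : ℝ) + 1) / (2 * (q : ℝ)) * Real.pi)

/-- The `r`-th Lagrange polynomial with respect to the `q` Chebyshev nodes of `[a, b]`. -/
def lagrange (q : ℕ) (a b : ℝ) (r : Fin q) (t : ℝ) : ℝ :=
  ∏ j ∈ Finset.univ.erase r,
    (t - chebNode q a b j) / (chebNode q a b r - chebNode q a b j)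

/-! ### Approximate Fourier transforms -/

/-- `cis t = exp (2 π i t)`. -/
def cis (t : ℝ) : ℂ := Complex.exp (2 * Real.pi * Complex.I * t)

/-- The type of a method for the approximate evaluation of the sums
`∑ k, fhat k * exp (2 π i ξ k x j)`: its arguments are the problem size `N`, a tolerance, the
spatial nodes `x`, the frequencies `ξ`, and the coefficients `fhat`. -/
abbrev FourierMethod : Type :=
  (N : ℕ) → ℝ → (Fin N → ℝ) → (Fin N → ℝ) → (Fin N → ℂ) → Flops (Fin N → ℂ)

/-- Direct evaluation of the sums. -/
def directFourier (N : ℕ) (x ξ : Fin N → ℝ) (fhat : Fin N → ℂ) : Flops (Fin N → ℂ) :=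
  Flops.forEach Finset.univ fun j =>
    Flops.lincomb Finset.univ (fun k => cis (ξ k * x j)) fhat

/-- Radix-2 fast Fourier transform of length `2 ^ n`: it maps `a` to the array
`l ↦ ∑ i < 2 ^ n, a i * exp (2 π i i l / 2 ^ n)`, `l < 2 ^ n`. -/
def fft : (n : ℕ) → (ℕ → ℂ) → Flops (ℕ → ℂ)
  | 0, a => pure a
  | n + 1, a => do
    let even ← fft n fun i => a (2 * i)
    let odd ← fft n fun i => a (2 * i + 1)
    Flops.forEach (Finset.range (2 ^ (n + 1))) fun l => do
      let t ← Flops.mul (cis ((l : ℝ) / 2 ^ (n + 1))) (odd (l % 2 ^ n))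
      Flops.add (even (l % 2 ^ n)) t

/-- The Gaussian window. -/
def window (β t : ℝ) : ℝ := Real.exp (-Real.pi * t ^ 2 / β)

/-- The Fourier transform of the Gaussian window. -/
def windowHat (β θ : ℝ) : ℝ := √β * Real.exp (-Real.pi * β * θ ^ 2)

/-- Window cut-off of the transform `nnfft` for the tolerance `δ`. -/
def cutoff (δ : ℝ) : ℕ := ⌈Real.log (1 / δ)⌉₊ + 10

/-- Position `a` of an array of length `P` holds the frequency `a` or `a - P`. -/
def signedIndex (P a : ℕ) : ℤ := if 2 * a < P then (a : ℤ) else (a : ℤ) - (P : ℤ)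

/-- The fast Fourier transform for nodes nonequispaced in time and frequency, for spatial nodes
in `[0, 1)` and frequencies in `[0, N]`, with truncated Gaussian windows in both domains.
The frequencies are spread to the grid `ℤ / 2` (oversampling factor two); the resulting equispaced
sum, with frequencies `t` around `N`, is evaluated at the nodes `θ j` by a nonequispaced fast
Fourier transform: deconvolution, a fast Fourier transform of length `2 ^ n`, and a local sum.
Problems that are not larger than the window cut-off are treated directly. -/
def nnfft : FourierMethod := fun N δ x ξ fhat =>
  let β : ℕ := cutoff δ
  let n : ℕ := Nat.clog 2 (4 * (N + β))
  let P : ℕ := 2 ^ n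
  let θ : Fin N → ℝ := fun j => (x j - 1 / 2) / 2
  if N ≤ β then directFourier N x ξ fhat
  else do
    let c ← Flops.forEach Finset.univ fun k => Flops.mul (cis (ξ k / 2)) (fhat k)
    let g ← Flops.forEach (Finset.range P) fun a => do
      let t : ℝ := (N : ℝ) + (signedIndex P a : ℝ)
      let s ← Flops.lincomb (Finset.univ.filter fun k => |2 * ξ k - t| ≤ (β : ℝ))
        (fun k => (window β (2 * ξ k - t) : ℂ)) c
      Flops.mul ((1 / windowHat β ((signedIndex P a : ℝ) / (P : ℝ)) : ℝ) : ℂ) s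
    let G ← fft n g
    Flops.forEach Finset.univ fun j => do
      let s ← Flops.lincomb
        (Finset.Icc ⌈(P : ℝ) * θ j - (β : ℝ)⌉ ⌊(P : ℝ) * θ j + (β : ℝ)⌋)
        (fun l : ℤ => (window β ((P : ℝ) * θ j - (l : ℝ)) : ℂ))
        (fun l : ℤ => G (l % (P : ℤ)).toNat)
      Flops.mul (cis (θ j * (N : ℝ)) / (windowHat β (θ j) : ℂ)) s

/-- Local expansion degree of the transform `bsfft` for problem size `N` and tolerance `δ`. -/
def expansionDegree (N : ℕ) (δ : ℝ) : ℕ :=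
  2 * Nat.clog 2 N + 2 * ⌈Real.log (1 / δ)⌉₊ + 20

/-- The `r`-th of the `p` Chebyshev nodes of the spatial box `[i / 2 ^ l, (i + 1) / 2 ^ l]`. -/
def boxNode (p l i : ℕ) (r : Fin p) : ℝ :=
  chebNode p ((i : ℝ) / 2 ^ l) (((i : ℝ) + 1) / 2 ^ l) r

/-- The Lagrange-type basis function, on the `i`-th spatial box of level `l`, for functions with
frequencies in the box `(b * 2 ^ l, (b + 1) * 2 ^ l]`: a Lagrange polynomial that is modulated
by the midpoint of the frequency box. -/
def boxBasis (p l i b : ℕ) (s : Fin p) (t : ℝ) : ℂ :=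
  cis (((b : ℝ) + 1 / 2) * 2 ^ l * (t - boxNode p l i s)) *
    (lagrange p ((i : ℝ) / 2 ^ l) (((i : ℝ) + 1) / 2 ^ l) s t : ℂ)

/-- The levels of the butterfly scheme of depth `L` and expansion degree `p`. On level `l` the
entry `i b r` approximates, at the `r`-th node of the spatial box `i` of length `2 ^ (-l)`, the
part of the sum with frequencies in the box `(b * 2 ^ l, (b + 1) * 2 ^ l]`. -/
def butterfly (N L p : ℕ) (ξ : Fin N → ℝ) (fhat : Fin N → ℂ) :
    ℕ → Flops (ℕ → ℕ → Fin p → ℂ)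
  | 0 =>
    Flops.forEach (Finset.range 1) fun i =>
      Flops.forEach (Finset.range (2 ^ L)) fun b =>
        Flops.forEach Finset.univ fun r =>
          Flops.lincomb (Finset.univ.filter fun k => (b : ℝ) < ξ k ∧ ξ k ≤ (b : ℝ) + 1)
            (fun k => cis (ξ k * boxNode p 0 i r)) fhat
  | l + 1 => do
    let v ← butterfly N L p ξ fhat l
    Flops.forEach (Finset.range (2 ^ (l + 1))) fun i =>
      Flops.forEach (Finset.range (2 ^ (L - (l + 1)))) fun b =>
        Flops.forEach Finset.univ fun r => do
          let left ← Flops.lincomb Finset.univ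
            (fun s => boxBasis p l (i / 2) (2 * b) s (boxNode p (l + 1) i r))
            (v (i / 2) (2 * b))
          let right ← Flops.lincomb Finset.univ
            (fun s => boxBasis p l (i / 2) (2 * b + 1) s (boxNode p (l + 1) i r))
            (v (i / 2) (2 * b + 1))
          Flops.add left right

/-- The butterfly sparse Fourier transform, for spatial nodes in `[0, 1)` and frequencies
in `(0, N]`. -/
def bsfft : FourierMethod := fun N δ x ξ fhat => do
  let L : ℕ := Nat.clog 2 N
  let p : ℕ := expansionDegree N δ
  let v ← butterfly N L p ξ fhat L
  Flops.forEach Finset.univ fun j => do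
    let i : ℕ := ⌊x j * 2 ^ L⌋₊
    Flops.lincomb Finset.univ (fun s => boxBasis p L i 0 s (x j)) (v i 0)

/-! ### Fast evaluation in the unit disk -/

/-- The dyadic decomposition of `[0, a]` into `M` intervals. -/
def dyadicBlock (a : ℝ) (M m : ℕ) : Set ℝ :=
  if m = M then Set.Icc 0 (a / 2 ^ (M - 1)) else Set.Ioc (a / 2 ^ m) (a / 2 ^ (m - 1))

/-- The index of the interval of the dyadic decomposition of `[0, a]` that contains `t`. -/
def blockIndex (a : ℝ) (M : ℕ) (t : ℝ) : ℕ :=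
  sInf {m : ℕ | 1 ≤ m ∧ m ≤ M ∧ t ∈ dyadicBlock a M m}

/-- The Lagrange polynomials of the closure of the `m`-th dyadic interval of `[0, a]`, `m < M`. -/
def blockLagrange (q : ℕ) (a : ℝ) (m : ℕ) (r : Fin q) (t : ℝ) : ℝ :=
  lagrange q (a / 2 ^ m) (a / 2 ^ (m - 1)) r t

/-- The Chebyshev nodes of the closure of the `m`-th dyadic interval of `[0, a]`, `m < M`. -/
def blockNode (q : ℕ) (a : ℝ) (m : ℕ) (r : Fin q) : ℝ :=
  chebNode q (a / 2 ^ m) (a / 2 ^ (m - 1)) r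

/-- The number of dyadic intervals (at least one). -/
def numBlocks (N : ℕ) (ε : ℝ) : ℕ :=
  max 1 (⌈Real.logb 2 ((N : ℝ) * Real.log (1 / ε) / ε)⌉ + 1).toNat

/-- The rank of the local approximations of the Laplace kernel. -/
def laplaceRank (ε : ℝ) : ℕ := ⌈1 / 2 + Real.logb 4 (1 / ε)⌉₊

/-- For nodes in the `m`-th band, the kernel is replaced by zero on frequency intervals with index
below `firstBlock`; here `y₁` and `ξ₁` are the lengths of the decomposed intervals. -/
def firstBlock (y₁ ξ₁ ε : ℝ) (m : ℕ) : ℕ :=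
  (max 1 (⌊Real.logb 2 (y₁ * ξ₁) - (m : ℝ) - Real.logb 2 (Real.log (1 / ε))⌋ + 1)).toNat

/-- The fast evaluation of `∑ k, fhat k * z j ^ ξ k` at nodes `z j` in the closed unit disk, for
exponents `ξ k` in `[1, N]`, with target accuracy `ε` and with the approximate Fourier
transform `F`. -/
def unitDiskEval (F : FourierMethod) (N : ℕ) (ε : ℝ) (ξ : Fin N → ℝ) (z : Fin N → ℂ)
    (fhat : Fin N → ℂ) : Flops (Fin N → ℂ) := do
  let M : ℕ := numBlocks N ε
  let q : ℕ := laplaceRank ε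
  -- polar form `z = exp (-y) * exp (2 π i x)` and the decomposed intervals `[0, y₁]`, `[0, ξ₁]`
  let x : Fin N → ℝ := fun j => Int.fract (Complex.arg (z j) / (2 * Real.pi))
  let y : Fin N → ℝ := fun j => -Real.log ‖z j‖
  let y₁ : ℝ := Real.log (1 / ε)
  let ξ₁ : ℝ := N
  let band : Fin N → ℕ := fun j => blockIndex y₁ M (y j)
  let block : Fin N → ℕ := fun k => blockIndex ξ₁ M (ξ k)
  -- multiplication with the approximate Fourier matrix
  let A : (Fin N → ℂ) → Flops (Fin N → ℂ) := F N (ε ^ 2 / 16) x ξ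
  let inner ← A fhat
  let Fhat ← Flops.forEach (Finset.univ.filter fun k => block k < M) fun k =>
    Flops.forEach Finset.univ fun r : Fin q =>
      Flops.mul (fhat k) (blockLagrange q ξ₁ (block k) r (ξ k) : ℂ)
  let outer ← Flops.forEach (Finset.Icc 1 (M - 1)) fun m => do
    let near ← A fun k => if M - m < block k then fhat k else 0
    let W ← Flops.forEach
      (Finset.univ.filter fun k => firstBlock y₁ ξ₁ ε m ≤ block k ∧ block k ≤ M - m) fun k =>
        Flops.forEach Finset.univ fun s : Fin q =>
          Flops.lincomb Finset.univ
            (fun r : Fin q =>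
              (Real.exp (-(blockNode q y₁ m s * blockNode q ξ₁ (block k) r)) : ℂ))
            (Fhat k)
    let FF ← Flops.forEach Finset.univ fun s : Fin q => A fun k => W k s
    Flops.forEach (Finset.univ.filter fun j => ε ≤ ‖z j‖ ∧ band j = m) fun j => do
      let t ← Flops.lincomb Finset.univ
        (fun s : Fin q => (blockLagrange q y₁ m s (y j) : ℂ)) (fun s => FF s j)
      Flops.add (near j) t
  pure fun j =>
    if ‖z j‖ < ε then 0
    else if band j = M then inner j
    else outer (band j) j

/-- The matrix `(z j ^ k)`, `j, k = 1, …, N`. -/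
def powerMatrix (N : ℕ) (z : Fin N → ℂ) : Matrix (Fin N) (Fin N) ℂ :=
  Matrix.of fun j k => z j ^ ((k : ℕ) + 1)

/-- The evaluation of the polynomial with coefficients `fhat` (exponents `1, …, N`). -/
def polyEval (F : FourierMethod) (N : ℕ) (ε : ℝ) (z : Fin N → ℂ) (fhat : Fin N → ℂ) :
    Flops (Fin N → ℂ) :=
  unitDiskEval F N ε (fun k => (k : ℝ) + 1) z fhat

end DiskEval

end

/-! # Fast evaluation of polynomials at nodes in the unit disk -/

namespace DiskEval

section

open Polynomial Finset

/-! ### Interpolation at Chebyshev nodes -/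

/-! Write z^k = e^{-yk} e^{2πixk}. A separable approximation Σ_s a_s(y) w_s(t) of the Laplace kernel
e^{-yt} turns the evaluation into a few Fourier sums with reweighted coefficients. On a pair of
dyadic intervals for y and t there are three cases. If yt ≤ ε, the kernel is replaced by 1; if yt ≥
log(1/ε), by 0. In between, tensor Chebyshev interpolation of degree below q works uniformly in the
scale: on [a, 2a] the q-th derivative s^q e^{-as} times (a/4)^q / q! is at most 4^{-q} up to a
Stirling factor, and q is about log_4(1/ε) (`abs_exp_sub_interpolate_le`,
`abs_exp_sub_blockInterpolate_le`). The Lebesgue constant √(2q - 1) controls both the second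
interpolation and the amplification of transform errors. Since 2q - 1 ≤ 2/ε, the tolerance ε²/16
suffices (`kernel_error_le`, `norm_eval_sub_le`).

The two Fourier transforms meet any tolerance for separate reasons. For the NNFFT, Poisson summation
shows that a Gaussian window reproduces an exponential up to aliases of size e^{-cβ}. Spreading and
resampling use this twice, and the loss by deconvolution is smaller than the gain
(`norm_double_window_sub_le`, `nnfft_isAccurate`). For the butterfly scheme, a space box and a
frequency box whose lengths multiply to 1 leave, after demodulation, a function with less than one
oscillation. Its interpolation error (π/4)^p / p! decays fast enough to beat the growth p^L of
errors through the L levels (`butterfly_error`, `expansionDegree_error_le`).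

For the cost, there are O(log(N/ε)) bands with q + 1 = O(log(1/ε)) transforms each. A transform
takes O(N log(N/ε)) flops by NNFFT and O(N log N log²(N/ε)) by the butterfly; the remaining work is
of lower order. -/

theorem chebNode_injective {q : ℕ} {a b : ℝ} (h : a < b) :
    Function.Injective (chebNode q a b) := by
  intro i j hij
  have hq : (0 : ℝ) < q := by exact_mod_cast i.pos
  have key : ∀ r : Fin q, (2 * (r : ℝ) + 1) / (2 * (q : ℝ)) * Real.pi ∈ Set.Icc 0 Real.pi := by
    intro r
    have : ((r : ℕ) : ℝ) + 1 ≤ q := by exact_mod_cast r.2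
    have h1 : (2 * (r : ℝ) + 1) / (2 * (q : ℝ)) ≤ 1 := by
      rw [div_le_one (by positivity)]; linarith
    exact ⟨by positivity, by nlinarith [Real.pi_pos]⟩
  have h2 : (b - a) / 2 ≠ 0 := by
    have : 0 < b - a := by linarith
    positivity
  have h3 := Real.injOn_cos (key i) (key j) (mul_left_cancel₀ h2 (add_left_cancel hij))
  have h4 := mul_right_cancel₀ Real.pi_ne_zero h3
  rw [div_left_inj' (by positivity)] at h4
  have h5 : ((i : ℕ) : ℝ) = (j : ℕ) := by linarith
  exact Fin.ext (by exact_mod_cast h5)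

theorem chebNode_mem {q : ℕ} {a b : ℝ} (h : a ≤ b) (r : Fin q) :
    chebNode q a b r ∈ Set.Icc a b := by
  unfold chebNode
  have h1 := Real.neg_one_le_cos ((2 * (r : ℝ) + 1) / (2 * (q : ℝ)) * Real.pi)
  have h2 := Real.cos_le_one ((2 * (r : ℝ) + 1) / (2 * (q : ℝ)) * Real.pi)
  constructor <;> nlinarith

theorem lagrange_eq_eval_basis (q : ℕ) (a b : ℝ) (r : Fin q) (x : ℝ) :
    lagrange q a b r x = (Lagrange.basis univ (chebNode q a b) r).eval x := by
  simp only [lagrange, Lagrange.basis, Lagrange.basisDivisor, eval_prod, eval_mul, eval_C,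
    eval_sub, eval_X]
  refine prod_congr rfl fun j _ => ?_
  rw [div_eq_inv_mul]

theorem eval_interpolate_chebNode (q : ℕ) (a b x : ℝ) (f : Fin q → ℝ) :
    (Lagrange.interpolate univ (chebNode q a b) f).eval x
      = ∑ r, lagrange q a b r x * f r := by
  simp [Lagrange.interpolate_apply, eval_finsetSum, lagrange_eq_eval_basis, mul_comm]

theorem sum_lagrange_mul_eval {q : ℕ} {a b : ℝ} (h : a < b) {P : ℝ[X]} (hP : P.degree < q)
    (x : ℝ) : ∑ r, lagrange q a b r x * P.eval (chebNode q a b r) = P.eval x := by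
  rw [← eval_interpolate_chebNode q a b x (fun r => P.eval (chebNode q a b r)),
    ← Lagrange.eq_interpolate (chebNode_injective h).injOn (by simpa using hP)]

theorem chebNode_affine {q : ℕ} (a b : ℝ) (j : Fin q) :
    chebNode q a b j = (a + b) / 2 + (b - a) / 2 * chebNode q (-1) 1 j := by
  simp only [chebNode]; ring

theorem lagrange_affine {q : ℕ} {a b : ℝ} (h : a < b) (r : Fin q) (u : ℝ) :
    lagrange q a b r ((a + b) / 2 + (b - a) / 2 * u) = lagrange q (-1) 1 r u := by
  have h2 : (b - a) / 2 ≠ 0 := by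
    have : 0 < b - a := by linarith
    positivity
  unfold lagrange
  refine prod_congr rfl fun j _ => ?_
  rw [chebNode_affine a b j, chebNode_affine a b r, add_sub_add_left_eq_sub,
    add_sub_add_left_eq_sub, ← mul_sub, ← mul_sub, mul_div_mul_left _ _ h2]

theorem exists_affine {a b x : ℝ} (h : a < b) (hx : x ∈ Set.Icc a b) :
    ∃ u : ℝ, |u| ≤ 1 ∧ x = (a + b) / 2 + (b - a) / 2 * u := by
  have h2 : 0 < b - a := by linarith
  refine ⟨(2 * x - a - b) / (b - a), ?_, by field_simp; ring⟩
  rw [abs_le, le_div_iff₀ h2, div_le_iff₀ h2]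
  constructor <;> linarith [hx.1, hx.2]

theorem chebNode_reference (q : ℕ) (r : Fin q) :
    chebNode q (-1) 1 r = Real.cos ((2 * (r : ℝ) + 1) / (2 * (q : ℝ)) * Real.pi) := by
  simp [chebNode]

theorem sum_eval_T_chebNode_of_not_dvd {q : ℕ} (hq : q ≠ 0) {k : ℤ} (hk : ¬ (2 * q : ℤ) ∣ k) :
    ∑ r : Fin q, (Chebyshev.T ℝ k).eval (chebNode q (-1) 1 r) = 0 := by
  have h := Chebyshev.sumZeroes_T_of_not_dvd hk
  rw [Chebyshev.sumZeroes, mul_eq_zero] at h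
  have h0 : Real.pi / q ≠ 0 := by
    have : (0 : ℝ) < q := by positivity
    positivity
  have h1 := h.resolve_left h0
  rw [Finset.sum_range] at h1
  simpa only [chebNode_reference] using h1

/-- Weights that make `T_k`, `k < q`, orthonormal on the Chebyshev nodes. -/
noncomputable def chebWeight (q k : ℕ) : ℝ := if k = 0 then √(1 / q) else √(2 / q)

theorem chebWeight_sq (q k : ℕ) :
    chebWeight q k ^ 2 = if k = 0 then 1 / (q : ℝ) else 2 / q := by
  unfold chebWeight
  split_ifs <;> rw [Real.sq_sqrt (by positivity)]

/-- Discrete orthogonality: T_j T_k = (T_{j+k} + T_{j-k}) / 2, both indices are smaller than 2q in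
absolute value, and such a T_m sums to zero over the nodes unless m = 0. -/
theorem sum_T_mul_T_chebNode {q : ℕ} (j k : Fin q) :
    ∑ r : Fin q, (chebWeight q j * (Chebyshev.T ℝ (j : ℕ)).eval (chebNode q (-1) 1 r)) *
      (chebWeight q k * (Chebyshev.T ℝ (k : ℕ)).eval (chebNode q (-1) 1 r))
      = if j = k then 1 else 0 := by
  have hq : q ≠ 0 := by have := j.pos; omega
  have hq' : (0 : ℝ) < q := by positivity
  have hT : ∀ x : ℝ, (Chebyshev.T ℝ (j : ℕ)).eval x * (Chebyshev.T ℝ (k : ℕ)).eval x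
      = ((Chebyshev.T ℝ ((j : ℕ) + (k : ℕ))).eval x
        + (Chebyshev.T ℝ ((j : ℕ) - (k : ℕ))).eval x) / 2 := by
    intro x
    have := congrArg (Polynomial.eval x) (Chebyshev.T_mul_T ℝ (j : ℕ) (k : ℕ))
    simp only [eval_mul, eval_add, eval_ofNat] at this
    linarith
  have h1 : ∑ r : Fin q, (chebWeight q j * (Chebyshev.T ℝ (j : ℕ)).eval (chebNode q (-1) 1 r)) *
      (chebWeight q k * (Chebyshev.T ℝ (k : ℕ)).eval (chebNode q (-1) 1 r))
      = chebWeight q j * chebWeight q k / 2 *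
        (∑ r : Fin q, (Chebyshev.T ℝ ((j : ℕ) + (k : ℕ))).eval (chebNode q (-1) 1 r)
          + ∑ r : Fin q, (Chebyshev.T ℝ ((j : ℕ) - (k : ℕ))).eval (chebNode q (-1) 1 r)) := by
    rw [← sum_add_distrib, mul_sum]
    refine sum_congr rfl fun r _ => ?_
    rw [mul_mul_mul_comm, hT]; ring
  rw [h1]
  have hj := j.2
  have hk := k.2
  have hdvd : ∀ m : ℤ, m ≠ 0 → |m| < 2 * q → ¬ (2 * q : ℤ) ∣ m := by
    intro m hm hlt hd
    have := Int.le_of_dvd (abs_pos.mpr hm) ((dvd_abs _ _).mpr hd)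
    omega
  split_ifs with hjk
  · subst hjk
    by_cases h0 : (j : ℕ) = 0
    · simp only [h0, sub_self, Nat.cast_zero, add_zero, Chebyshev.T_zero, eval_one, sum_const,
        card_univ, Fintype.card_fin, nsmul_eq_mul, mul_one]
      have := chebWeight_sq q 0
      simp only [if_true] at this
      rw [← sq, this]; field_simp; norm_num
    · rw [sum_eval_T_chebNode_of_not_dvd hq (hdvd _ (by omega) (by rw [abs_lt]; omega))]
      simp only [sub_self, Chebyshev.T_zero, eval_one, sum_const,
        card_univ, Fintype.card_fin, nsmul_eq_mul, mul_one]
      have := chebWeight_sq q j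
      rw [if_neg h0] at this
      rw [← sq, this]; field_simp; norm_num
  · have hne : (j : ℕ) ≠ k := fun h => hjk (Fin.ext h)
    rw [sum_eval_T_chebNode_of_not_dvd hq (hdvd _ (by omega) (by rw [abs_lt]; omega)),
      sum_eval_T_chebNode_of_not_dvd hq (hdvd _ (by omega) (by rw [abs_lt]; omega))]
    ring

/-- The weighted Chebyshev values at the nodes form an orthogonal matrix, which sends the vector of
Lagrange values at u to that of the weighted T_k(u). Norms agree, and |T_k(u)| ≤ 1 leaves 1/q + (q -
1) · 2/q. -/
theorem sum_lagrange_sq_le {q : ℕ} (hq : 1 ≤ q) {u : ℝ} (hu : |u| ≤ 1) :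
    ∑ r : Fin q, lagrange q (-1) 1 r u ^ 2 ≤ (2 * q - 1) / q := by
  let V : Matrix (Fin q) (Fin q) ℝ := Matrix.of fun k r =>
    chebWeight q k * (Chebyshev.T ℝ (k : ℕ)).eval (chebNode q (-1) 1 r)
  have hV : V * V.transpose = 1 := by
    ext j k
    rw [Matrix.mul_apply, Matrix.one_apply]
    exact sum_T_mul_T_chebNode j k
  have hV' : V.transpose * V = 1 := mul_eq_one_comm.mp hV
  let ell : Fin q → ℝ := fun r => lagrange q (-1) 1 r u
  have h1 : ∀ k, V.mulVec ell k = chebWeight q k * (Chebyshev.T ℝ (k : ℕ)).eval u := by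
    intro k
    have hdeg : (Chebyshev.T ℝ (k : ℕ)).degree < q := by
      rw [Chebyshev.degree_T]; simp
    rw [← sum_lagrange_mul_eval (a := -1) (b := 1) (by norm_num) hdeg u, mul_sum]
    rw [Matrix.mulVec, dotProduct]
    refine sum_congr rfl fun r _ => ?_
    change chebWeight q k * (Chebyshev.T ℝ (k : ℕ)).eval (chebNode q (-1) 1 r)
      * lagrange q (-1) 1 r u = _
    ring
  have h2 : ∑ r, ell r ^ 2 = ∑ k, (V.mulVec ell k) ^ 2 := by
    have e1 : ∀ w : Fin q → ℝ, ∑ r, w r ^ 2 = w ⬝ᵥ w := fun w =>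
      sum_congr rfl fun r _ => sq _
    rw [e1, e1, Matrix.dotProduct_mulVec, Matrix.vecMul_mulVec, ← Matrix.mulVec_transpose]
    simp [hV']
  change ∑ r, ell r ^ 2 ≤ _
  rw [h2]
  have h3 : ∀ k : Fin q, (V.mulVec ell k) ^ 2 ≤ if (k : ℕ) = 0 then 1 / (q : ℝ) else 2 / q := by
    intro k
    rw [h1, mul_pow, chebWeight_sq]
    have := Chebyshev.abs_eval_T_real_le_one (k : ℕ) hu
    refine mul_le_of_le_one_right (by split_ifs <;> positivity) ?_
    rwa [sq_le_one_iff_abs_le_one]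
  refine (sum_le_sum fun k _ => h3 k).trans ?_
  rw [Fin.sum_univ_eq_sum_range (fun k => if k = 0 then 1 / (q : ℝ) else 2 / q)]
  obtain ⟨m, rfl⟩ : ∃ m, q = m + 1 := ⟨q - 1, by omega⟩
  rw [sum_range_succ']
  simp only [Nat.add_eq_zero_iff, one_ne_zero, and_false, if_false, if_true, sum_const, card_range,
    nsmul_eq_mul]
  push_cast
  apply le_of_eq; field_simp; ring

/-- The Lebesgue constant of interpolation at `q` Chebyshev nodes is at most `√(2 q - 1)`. -/
theorem sum_abs_lagrange_le {q : ℕ} (hq : 1 ≤ q) {a b x : ℝ} (h : a < b) (hx : x ∈ Set.Icc a b) :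
    ∑ r : Fin q, |lagrange q a b r x| ≤ √(2 * q - 1) := by
  obtain ⟨u, hu, rfl⟩ := exists_affine h hx
  simp only [lagrange_affine h]
  apply Real.le_sqrt_of_sq_le
  have h1 := sq_sum_le_card_mul_sum_sq (s := (univ : Finset (Fin q)))
    (f := fun r => |lagrange q (-1) 1 r u|)
  simp only [sq_abs, card_univ, Fintype.card_fin] at h1
  have h2 := sum_lagrange_sq_le hq hu
  have hq' : (0 : ℝ) < q := by positivity
  rw [le_div_iff₀ hq'] at h2
  linarith

/-- On [-1, 1] the nodal polynomial is T_q / 2^{q-1}, because the nodes are the roots of T_q;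
rescaling contributes ((b - a)/2)^q. -/
theorem abs_prod_sub_chebNode_le {q : ℕ} (hq : 1 ≤ q) {a b x : ℝ} (h : a < b)
    (hx : x ∈ Set.Icc a b) :
    |∏ r : Fin q, (x - chebNode q a b r)| ≤ 2 * ((b - a) / 4) ^ q := by
  obtain ⟨u, hu, rfl⟩ := exists_affine h hx
  have hT : (Chebyshev.T ℝ q).eval u = 2 ^ (q - 1) * ∏ r : Fin q, (u - chebNode q (-1) 1 r) := by
    have hs : (Chebyshev.T ℝ q).roots.card = (Chebyshev.T ℝ q).natDegree := by
      rw [Chebyshev.roots_T_real, Chebyshev.natDegree_T, Finset.card_val,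
        Finset.card_image_of_injOn, Finset.card_range]
      · simp
      · exact (Finset.range q).nodup_map_iff_injOn.mp (Chebyshev.roots_T_real_nodup q)
    have h1 := C_leadingCoeff_mul_prod_multiset_X_sub_C hs
    have h2 := congrArg (Polynomial.eval u) h1
    rw [← h2, Chebyshev.roots_T_real, Chebyshev.leadingCoeff_T, eval_mul, eval_C,
      ← Finset.prod_eq_multiset_prod, Finset.prod_image, eval_prod, Finset.prod_range]
    · simp only [eval_sub, eval_X, eval_C, chebNode_reference, Int.natAbs_natCast]
      congr 1
      refine prod_congr rfl fun r _ => ?_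
      congr 2; ring
    · exact (Finset.range q).nodup_map_iff_injOn.mp (Chebyshev.roots_T_real_nodup q)
  have h3 : ∏ r : Fin q, ((a + b) / 2 + (b - a) / 2 * u - chebNode q a b r)
      = ((b - a) / 2) ^ q * ∏ r : Fin q, (u - chebNode q (-1) 1 r) := by
    have : ∀ r : Fin q, (a + b) / 2 + (b - a) / 2 * u - chebNode q a b r
        = (b - a) / 2 * (u - chebNode q (-1) 1 r) := by
      intro r; rw [chebNode_affine a b]; ring
    rw [prod_congr rfl fun r _ => this r, prod_mul_distrib, prod_const, card_univ,
      Fintype.card_fin]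
  have h4 := Chebyshev.abs_eval_T_real_le_one q hu
  rw [hT, abs_mul, abs_of_pos (by positivity : (0 : ℝ) < 2 ^ (q - 1))] at h4
  have h5 : 0 < b - a := by linarith
  rw [h3, abs_mul, abs_of_pos (by positivity : (0 : ℝ) < ((b - a) / 2) ^ q)]
  have h6 : 2 * ((b - a) / 4) ^ q = ((b - a) / 2) ^ q * (1 / 2 ^ (q - 1)) := by
    obtain ⟨m, rfl⟩ : ∃ m, q = m + 1 := ⟨q - 1, by omega⟩
    rw [Nat.add_sub_cancel, div_pow, div_pow, (by norm_num : (4 : ℝ) = 2 * 2), mul_pow, pow_succ 2 m]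
    field_simp
  rw [h6]
  gcongr
  rw [le_div_iff₀ (by positivity)]
  linarith

/-- Rolle's theorem for higher derivatives. -/
theorem exists_deriv_eq_zero_of_zeros {f : ℕ → ℝ → ℝ}
    (hf : ∀ n x, HasDerivAt (f n) (f (n + 1) x) x) {a b : ℝ} (n : ℕ) :
    ∀ k, ∀ s : Finset ℝ, s.card = n + 1 → (∀ x ∈ s, x ∈ Set.Icc a b ∧ f k x = 0) →
      ∃ c ∈ Set.Icc a b, f (k + n) c = 0 := by
  induction n with
  | zero =>
    intro k s hs h
    obtain ⟨x, hx⟩ : s.Nonempty := by rw [← card_pos]; omega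
    exact ⟨x, h x hx⟩
  | succ n ih =>
    intro k s hs h
    let e := s.orderEmbOfFin hs
    have he : ∀ i, e i ∈ Set.Icc a b ∧ f k (e i) = 0 := fun i => h _ (s.orderEmbOfFin_mem hs i)
    -- Rolle gives a zero of the next derivative in each gap between consecutive zeros; the gaps are
    -- disjoint and ordered, so these zeros are distinct.
    have hc : ∀ i : Fin (n + 1), ∃ c, c ∈ Set.Ioo (e i.castSucc) (e i.succ) ∧ f (k + 1) c = 0 := by
      intro i
      have hlt : e i.castSucc < e i.succ := e.strictMono (Fin.castSucc_lt_succ (i := i))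
      obtain ⟨c, hc, hd⟩ := exists_hasDerivAt_eq_zero hlt
        (fun x _ => (hf k x).continuousAt.continuousWithinAt)
        ((he _).2.trans (he _).2.symm) (fun x _ => hf k x)
      exact ⟨c, hc, hd⟩
    choose c hc hd using hc
    have hmono : StrictMono c := by
      intro i j hij
      have h1 : e i.succ ≤ e j.castSucc := e.monotone (by
        rw [Fin.le_def]; simpa using hij)
      exact (hc i).2.trans_le (h1.trans (hc j).1.le)
    obtain ⟨x, hx, h0⟩ := ih (k + 1) (univ.image c)
      (by rw [card_image_of_injective _ hmono.injective, card_univ, Fintype.card_fin])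
      (by
        intro x hx
        obtain ⟨i, -, rfl⟩ := mem_image.mp hx
        exact ⟨⟨(he _).1.1.trans (hc i).1.le, (hc i).2.le.trans (he _).1.2⟩, hd i⟩)
    exact ⟨x, hx, by rwa [show k + (n + 1) = k + 1 + n by ring]⟩

/-- The error of interpolation at `q` Chebyshev nodes; `f n` is the `n`-th derivative of `f 0`. -/
theorem abs_sub_interpolate_le {f : ℕ → ℝ → ℝ}
    (hf : ∀ n x, HasDerivAt (f n) (f (n + 1) x) x) {q : ℕ} (hq : 1 ≤ q) {a b B : ℝ} (h : a < b)
    (hB : ∀ x ∈ Set.Icc a b, |f q x| ≤ B) {x : ℝ} (hx : x ∈ Set.Icc a b) :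
    |f 0 x - ∑ r : Fin q, lagrange q a b r x * f 0 (chebNode q a b r)|
      ≤ B * (2 * ((b - a) / 4) ^ q / q.factorial) := by
  set v := chebNode q a b with hv
  have hinj : Function.Injective v := chebNode_injective h
  set P := Lagrange.interpolate univ v (fun r => f 0 (v r)) with hP
  have hPx : ∀ t, P.eval t = ∑ r : Fin q, lagrange q a b r t * f 0 (v r) := fun t =>
    eval_interpolate_chebNode q a b t _
  have hB0 : 0 ≤ B := (abs_nonneg _).trans (hB x hx)
  have hba : 0 < b - a := by linarith
  by_cases hnode : ∃ r, x = v r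
  · obtain ⟨r, rfl⟩ := hnode
    rw [← hPx, hP, Lagrange.eval_interpolate_at_node _ hinj.injOn (mem_univ r), sub_self, abs_zero]
    positivity
  push Not at hnode
  set W := Lagrange.nodal univ v with hW
  have hWx : W.eval x = ∏ r : Fin q, (x - v r) := Lagrange.eval_nodal
  have hWx0 : W.eval x ≠ 0 := by
    rw [hWx, prod_ne_zero_iff]
    exact fun r _ => sub_ne_zero.mpr (hnode r)
  -- With this c the polynomial Q also interpolates at x, so f - Q has q + 1 zeros, while the q-th
  -- derivative of Q is the constant q! · c. Rolle then identifies c with a value of f^{(q)} / q!.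
  set c := (f 0 x - P.eval x) / W.eval x with hc
  set Q := P + C c * W with hQ
  have hPdeg : P.degree < q := by
    have := Lagrange.degree_interpolate_lt (r := fun r => f 0 (v r)) (s := univ) hinj.injOn
    rwa [card_univ, Fintype.card_fin] at this
  have hcoef : Q.coeff q = c := by
    have h1 : P.coeff q = 0 := coeff_eq_zero_of_degree_lt hPdeg
    have h2 : W.coeff q = 1 := by
      have := Lagrange.nodal_monic (s := univ) (v := v)
      rw [Monic, leadingCoeff, Lagrange.natDegree_nodal] at this
      simpa using this
    rw [hQ, coeff_add, coeff_C_mul, h1, h2]; ring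
  have hdeg : Q.natDegree ≤ q := by
    refine natDegree_add_le_of_degree_le ?_ ?_
    · exact natDegree_le_of_degree_le hPdeg.le
    · refine (natDegree_C_mul_le _ _).trans ?_
      rw [hW, Lagrange.natDegree_nodal]; simp
  have hQd : derivative^[q] Q = C (q.factorial * c) := by
    rw [eq_C_of_natDegree_le_zero (p := derivative^[q] Q)
      ((natDegree_iterate_derivative Q q).trans (by omega)), coeff_iterate_derivative,
      zero_add, hcoef, Nat.descFactorial_self, nsmul_eq_mul]
  obtain ⟨ξ, hξ, h0⟩ := exists_deriv_eq_zero_of_zeros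
    (f := fun n t => f n t - (derivative^[n] Q).eval t)
    (fun n t => by
      have := (hf n t).sub ((derivative^[n] Q).hasDerivAt t)
      rw [Function.iterate_succ_apply']
      exact this) (a := a) (b := b) q 0 (insert x (univ.image v))
    (by
      rw [card_insert_of_notMem, card_image_of_injective _ hinj, card_univ, Fintype.card_fin]
      simpa [eq_comm] using hnode)
    (by
      intro t ht
      rcases mem_insert.mp ht with rfl | ht
      · refine ⟨hx, ?_⟩
        simp only [Function.iterate_zero, id, hQ, eval_add, eval_mul, eval_C, hc]
        field_simp; ring
      · obtain ⟨r, -, rfl⟩ := mem_image.mp ht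
        refine ⟨chebNode_mem h.le r, ?_⟩
        simp only [Function.iterate_zero, id, hQ, eval_add, eval_mul, eval_C]
        rw [hW, Lagrange.eval_nodal_at_node (mem_univ r), hP,
          Lagrange.eval_interpolate_at_node _ hinj.injOn (mem_univ r)]
        ring)
  simp only [zero_add, hQd, eval_C] at h0
  have hfact : (0 : ℝ) < q.factorial := by positivity
  have hceq : c = f q ξ / q.factorial := by field_simp; linarith
  have : f 0 x - ∑ r : Fin q, lagrange q a b r x * f 0 (v r)
      = f q ξ / q.factorial * ∏ r : Fin q, (x - v r) := by
    rw [← hPx, ← hWx, ← hceq, hc]; field_simp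
  rw [this, abs_mul, abs_div, abs_of_pos hfact]
  calc |f q ξ| / q.factorial * |∏ r : Fin q, (x - v r)|
      ≤ B / q.factorial * (2 * ((b - a) / 4) ^ q) := by
        gcongr
        · exact hB ξ hξ
        · exact abs_prod_sub_chebNode_le hq h hx
    _ = _ := by ring

end

end DiskEval

namespace DiskEval

section

open Finset

/-! ### Separable approximation of the Laplace kernel -/

/-- The maximum is at t = q; it follows from 1 + u ≤ e^u with u = t/q - 1. -/
theorem pow_mul_exp_neg_le (q : ℕ) {t : ℝ} (ht : 0 ≤ t) :
    t ^ q * Real.exp (-t) ≤ (q / Real.exp 1) ^ q := by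
  rcases Nat.eq_zero_or_pos q with rfl | hq
  · simpa using ht
  have hq' : (0 : ℝ) < q := by exact_mod_cast hq
  have h1 : t ≤ q * Real.exp (t / q - 1) := by
    have := Real.add_one_le_exp (t / q - 1)
    rw [sub_add_cancel, div_le_iff₀ hq'] at this
    linarith
  have h2 : t ^ q ≤ q ^ q * Real.exp (t - q) := by
    calc t ^ q ≤ (q * Real.exp (t / q - 1)) ^ q := pow_le_pow_left₀ ht h1 q
      _ = _ := by
        rw [mul_pow, ← Real.exp_nat_mul]
        congr 2; field_simp
  calc t ^ q * Real.exp (-t) ≤ q ^ q * Real.exp (t - q) * Real.exp (-t) := by gcongr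
    _ = (q / Real.exp 1) ^ q := by
      rw [mul_assoc, ← Real.exp_add, div_pow, ← Real.exp_nat_mul, div_eq_mul_inv, ← Real.exp_neg]
      congr 2; ring

/-- The bound depends neither on the scale a nor on s: derivative and interval length combine to
(as)^q e^{-as} ≤ (q/e)^q, and Stirling cancels this against q!. The condition b = 2a, satisfied by
dyadic intervals, gives the rate 1/4. -/
theorem abs_exp_sub_interpolate_le {q : ℕ} (hq : 1 ≤ q) {a b s y : ℝ} (ha : 0 < a) (hb : b = 2 * a)
    (hs : 0 ≤ s) (hy : y ∈ Set.Icc a b) :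
    |Real.exp (-(y * s)) - ∑ r : Fin q, lagrange q a b r y * Real.exp (-(chebNode q a b r * s))|
      ≤ 2 * (1 / 4) ^ q / √(2 * Real.pi * q) := by
  have hab : a < b := by linarith
  have hq' : (0 : ℝ) < q := by exact_mod_cast hq
  have hf : ∀ (n : ℕ) (x : ℝ), HasDerivAt (fun x => (-s) ^ n * Real.exp (-(x * s)))
      ((-s) ^ (n + 1) * Real.exp (-(x * s))) x := by
    intro n x
    have h1 : HasDerivAt (fun x : ℝ => -(x * s)) (-(1 * s)) x :=
      ((hasDerivAt_id x).mul_const s).neg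
    refine (h1.exp.const_mul ((-s) ^ n)).congr_deriv ?_
    ring
  have h := abs_sub_interpolate_le (f := fun n x => (-s) ^ n * Real.exp (-(x * s))) hf hq hab
    (B := s ^ q * Real.exp (-(a * s))) (by
      intro x hx
      rw [abs_mul, abs_pow, abs_neg, abs_of_nonneg hs, Real.abs_exp]
      gcongr
      exact hx.1) hy
  simp only [pow_zero, one_mul] at h
  refine h.trans ?_
  have h1 := pow_mul_exp_neg_le q (mul_nonneg ha.le hs)
  have h2 := Stirling.le_factorial_stirling q
  have hsq : 0 < √(2 * Real.pi * q) := Real.sqrt_pos.mpr (by positivity)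
  have hfac : (0 : ℝ) < q.factorial := by positivity
  calc s ^ q * Real.exp (-(a * s)) * (2 * ((b - a) / 4) ^ q / q.factorial)
      = 2 * (1 / 4) ^ q * (((a * s) ^ q * Real.exp (-(a * s))) / q.factorial) := by
        rw [hb, show (2 * a - a) / 4 = a * (1 / 4) by ring, mul_pow, mul_pow]; ring
    _ ≤ 2 * (1 / 4) ^ q * (1 / √(2 * Real.pi * q)) := by
        refine mul_le_mul_of_nonneg_left ?_ (by positivity)
        rw [div_le_div_iff₀ hfac hsq]
        nlinarith
    _ = _ := by ring

theorem one_le_laplaceRank {ε : ℝ} (h0 : 0 < ε) (h1 : ε < 1) : 1 ≤ laplaceRank ε := by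
  have : 0 < Real.logb 4 (1 / ε) := Real.logb_pos (by norm_num) (by rw [lt_div_iff₀ h0]; linarith)
  exact Nat.one_le_ceil_iff.mpr (by linarith)

/-- The summand 1/2 in the rank supplies the extra factor 4^{1/2} = 2. -/
theorem quarter_pow_laplaceRank_le {ε : ℝ} (h0 : 0 < ε) : (1 / 4 : ℝ) ^ laplaceRank ε ≤ ε / 2 := by
  have h : 1 / 2 + Real.logb 4 (1 / ε) ≤ laplaceRank ε := Nat.le_ceil _
  have h2 : (4 : ℝ) ^ (1 / 2 + Real.logb 4 (1 / ε)) ≤ (4 : ℝ) ^ (laplaceRank ε : ℝ) :=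
    Real.rpow_le_rpow_of_exponent_le (by norm_num) h
  rw [Real.rpow_natCast, Real.rpow_add (by norm_num), Real.rpow_logb (by norm_num) (by norm_num)
    (by positivity), ← Real.sqrt_eq_rpow, show (4 : ℝ) = 2 ^ 2 by norm_num,
    Real.sqrt_sq (by norm_num)] at h2
  rw [one_div_pow, div_le_iff₀ (by positivity)]
  rw [mul_one_div, div_le_iff₀ h0] at h2
  norm_num at h2 ⊢
  linarith

/-- 2q - 1 is the product of the two Lebesgue constants by which transform errors are amplified; it
is at most 2 + 2 log(1/ε) ≤ 2/ε. -/
theorem laplaceRank_mul_le {ε : ℝ} (h0 : 0 < ε) (h1 : ε < 1) :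
    (2 * (laplaceRank ε : ℝ) - 1) * ε ≤ 2 := by
  have hl : 0 ≤ Real.log (1 / ε) := Real.log_nonneg (by rw [le_div_iff₀ h0]; linarith)
  have h4 : Real.log 4 = 2 * Real.log 2 := by
    rw [show (4 : ℝ) = 2 ^ 2 by norm_num, Real.log_pow]; norm_num
  have hlog2 : 1 / 2 ≤ Real.log 2 := by linarith [Real.log_two_gt_d9]
  have hlogb : Real.logb 4 (1 / ε) ≤ Real.log (1 / ε) := by
    rw [Real.logb, h4]
    exact div_le_self hl (by linarith)
  have hq : (laplaceRank ε : ℝ) < 1 / 2 + Real.logb 4 (1 / ε) + 1 :=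
    Nat.ceil_lt_add_one (by
      have : 0 ≤ Real.logb 4 (1 / ε) := Real.logb_nonneg (by norm_num)
        (by rw [le_div_iff₀ h0]; linarith)
      linarith)
  have hle : Real.log (1 / ε) ≤ 1 / ε - 1 := Real.log_le_sub_one_of_pos (by positivity)
  have : 2 * (laplaceRank ε : ℝ) - 1 ≤ 2 / ε := by
    have h5 : 2 / ε = 2 * (1 / ε) := by ring
    rw [h5]; linarith
  rwa [le_div_iff₀ h0] at this

theorem block_endpoints {A : ℝ} {m : ℕ} (hm : 1 ≤ m) : A / 2 ^ (m - 1) = 2 * (A / 2 ^ m) := by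
  obtain ⟨n, rfl⟩ : ∃ n, m = n + 1 := ⟨m - 1, by omega⟩
  rw [Nat.add_sub_cancel, pow_succ]; field_simp

theorem block_lt {A : ℝ} (hA : 0 < A) {m : ℕ} (hm : 1 ≤ m) : A / 2 ^ m < A / 2 ^ (m - 1) := by
  rw [block_endpoints hm]
  have : 0 < A / 2 ^ m := by positivity
  linarith

theorem blockNode_nonneg {q : ℕ} {A : ℝ} (hA : 0 < A) {m : ℕ} (hm : 1 ≤ m) (r : Fin q) :
    0 ≤ blockNode q A m r :=
  (by positivity : 0 ≤ A / 2 ^ m).trans (chebNode_mem (block_lt hA hm).le r).1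

theorem sum_abs_blockLagrange_le {q : ℕ} (hq : 1 ≤ q) {A : ℝ} (hA : 0 < A) {m : ℕ} (hm : 1 ≤ m)
    {t : ℝ} (ht : t ∈ Set.Icc (A / 2 ^ m) (A / 2 ^ (m - 1))) :
    ∑ r, |blockLagrange q A m r t| ≤ √(2 * q - 1) :=
  sum_abs_lagrange_le hq (block_lt hA hm) ht

/-- Tensor product interpolation approximates the Laplace kernel on a product of dyadic
intervals. -/
theorem abs_exp_sub_blockInterpolate_le {ε : ℝ} (h0 : 0 < ε) (h1 : ε < 1) {A B y t : ℝ} (hA : 0 < A)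
    (hB : 0 < B) {m l : ℕ} (hm : 1 ≤ m) (hl : 1 ≤ l)
    (hy : y ∈ Set.Icc (A / 2 ^ m) (A / 2 ^ (m - 1)))
    (ht : t ∈ Set.Icc (B / 2 ^ l) (B / 2 ^ (l - 1))) :
    |Real.exp (-(y * t)) - ∑ s, blockLagrange (laplaceRank ε) A m s y *
        ∑ r, Real.exp (-(blockNode (laplaceRank ε) A m s * blockNode (laplaceRank ε) B l r)) *
          blockLagrange (laplaceRank ε) B l r t| ≤ 4 / 5 * ε := by
  have hq := one_le_laplaceRank h0 h1
  have hqε := quarter_pow_laplaceRank_le h0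
  set q := laplaceRank ε
  have hq' : (1 : ℝ) ≤ q := by exact_mod_cast hq
  have ht0 : 0 ≤ t := (by positivity : 0 ≤ B / 2 ^ l).trans ht.1
  set E : ℝ := 2 * (1 / 4) ^ q / √(2 * Real.pi * q) with hE
  have e1 : |Real.exp (-(y * t)) - ∑ s, blockLagrange q A m s y *
      Real.exp (-(blockNode q A m s * t))| ≤ E :=
    abs_exp_sub_interpolate_le hq (by positivity) (block_endpoints hm) ht0 hy
  have e2 : ∀ s : Fin q, |Real.exp (-(blockNode q A m s * t)) -
      ∑ r, Real.exp (-(blockNode q A m s * blockNode q B l r)) * blockLagrange q B l r t| ≤ E := by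
    intro s
    have := abs_exp_sub_interpolate_le (q := q) hq (by positivity : 0 < B / 2 ^ l)
      (block_endpoints hl) (blockNode_nonneg hA hm s) ht
    simp only [mul_comm _ (blockNode q A m s)] at this
    simp only [mul_comm _ (blockLagrange q B l _ t)]
    exact this
  have e3 := sum_abs_blockLagrange_le hq hA hm hy
  have hE0 : 0 ≤ E := by positivity
  have key : |Real.exp (-(y * t)) - ∑ s, blockLagrange q A m s y *
        ∑ r, Real.exp (-(blockNode q A m s * blockNode q B l r)) * blockLagrange q B l r t|
      ≤ E * (1 + √(2 * q - 1)) := by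
    -- Interpolation in y comes first, then interpolation in t at every node of the y-interval; the
    -- Lebesgue constant multiplies only the second error.
    have split : Real.exp (-(y * t)) - ∑ s, blockLagrange q A m s y *
        ∑ r, Real.exp (-(blockNode q A m s * blockNode q B l r)) * blockLagrange q B l r t
        = (Real.exp (-(y * t)) - ∑ s, blockLagrange q A m s y *
          Real.exp (-(blockNode q A m s * t))) + ∑ s, blockLagrange q A m s y *
          (Real.exp (-(blockNode q A m s * t)) - ∑ r,
            Real.exp (-(blockNode q A m s * blockNode q B l r)) * blockLagrange q B l r t) := by
      simp only [mul_sub, sum_sub_distrib]; ring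
    rw [split]
    refine (abs_add_le _ _).trans ?_
    rw [mul_add, mul_one]
    refine add_le_add e1 ((abs_sum_le_sum_abs _ _).trans ?_)
    calc _ ≤ ∑ s, |blockLagrange q A m s y| * E := by
          refine sum_le_sum fun s _ => ?_
          rw [abs_mul]
          exact mul_le_mul_of_nonneg_left (e2 s) (abs_nonneg _)
      _ = (∑ s, |blockLagrange q A m s y|) * E := by rw [sum_mul]
      _ ≤ √(2 * q - 1) * E := by gcongr
      _ = _ := by ring
  refine key.trans ?_
  have hsq : 0 < √(2 * Real.pi * q) := Real.sqrt_pos.mpr (by positivity)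
  -- Since (1 + √(2q - 1))² ≤ 4q, the constant 4/5 needs 4 ≤ (16/25) · 2π, which holds narrowly and
  -- already for 3.14.
  have hΛ : 1 + √(2 * q - 1) ≤ 4 / 5 * √(2 * Real.pi * q) := by
    have s1 : √(2 * (q : ℝ) - 1) ^ 2 = 2 * q - 1 := Real.sq_sqrt (by linarith)
    have s2 : √(2 * Real.pi * (q : ℝ)) ^ 2 = 2 * Real.pi * q := Real.sq_sqrt (by positivity)
    have hpi : 3.14 < Real.pi := Real.pi_gt_d2
    refine (pow_le_pow_iff_left₀ (by positivity) (by positivity) two_ne_zero).mp ?_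
    nlinarith [sq_nonneg (√(2 * (q : ℝ) - 1) - 1)]
  rw [hE, div_mul_eq_mul_div, div_le_iff₀ hsq]
  calc 2 * (1 / 4) ^ q * (1 + √(2 * q - 1)) ≤ 2 * (ε / 2) * (4 / 5 * √(2 * Real.pi * q)) := by
        gcongr
    _ = _ := by ring

end

end DiskEval

namespace DiskEval

section

open Finset

/-! ### Accuracy of the evaluation in the unit disk -/

/-- `F` multiplies with the Fourier matrix up to an entrywise error `δ`. -/
def FourierMethod.IsAccurate (F : FourierMethod) (N : ℕ) (δ : ℝ) (x ξ : Fin N → ℝ) : Prop :=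
  ∀ c j, ‖(F N δ x ξ c).val j - ∑ k, cis (ξ k * x j) * c k‖ ≤ δ * ∑ k, ‖c k‖

theorem norm_cis (t : ℝ) : ‖cis t‖ = 1 := by
  rw [cis, show (2 : ℂ) * Real.pi * Complex.I * t = ((2 * Real.pi * t : ℝ) : ℂ) * Complex.I by
    push_cast; ring]
  exact Complex.norm_exp_ofReal_mul_I _

theorem cis_add (s t : ℝ) : cis (s + t) = cis s * cis t := by
  simp only [cis, ← Complex.exp_add]; push_cast; ring_nf

theorem cis_int (n : ℤ) : cis n = 1 := by
  rw [cis]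
  convert Complex.exp_int_mul_two_pi_mul_I n using 2
  push_cast; ring

theorem cis_add_int (t : ℝ) (n : ℤ) : cis (t + n) = cis t := by rw [cis_add, cis_int, mul_one]

theorem one_le_numBlocks (N : ℕ) (ε : ℝ) : 1 ≤ numBlocks N ε := le_max_left _ _

/-- This inequality dictates the number of blocks: every product yt in the near field is at most the
left-hand side. -/
theorem div_two_pow_numBlocks_le {N : ℕ} (hN : 1 ≤ N) {ε : ℝ} (h0 : 0 < ε) (h1 : ε < 1) :
    N * Real.log (1 / ε) / 2 ^ (numBlocks N ε - 1) ≤ ε := by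
  have hl : 0 < Real.log (1 / ε) := Real.log_pos (by rw [lt_div_iff₀ h0]; linarith)
  have hN' : (0 : ℝ) < N := by exact_mod_cast hN
  have hpos : 0 < N * Real.log (1 / ε) / ε := by positivity
  rw [div_le_iff₀ (by positivity), mul_comm ε, ← div_le_iff₀ h0]
  have hb : Real.logb 2 (N * Real.log (1 / ε) / ε) ≤ ((numBlocks N ε - 1 : ℕ) : ℝ) := by
    refine (Int.le_ceil _).trans ?_
    have : ⌈Real.logb 2 (N * Real.log (1 / ε) / ε)⌉ ≤ ((numBlocks N ε - 1 : ℕ) : ℤ) := by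
      unfold numBlocks; omega
    exact_mod_cast this
  rw [Real.logb_le_iff_le_rpow (by norm_num) hpos, Real.rpow_natCast] at hb
  exact hb

theorem blockIndex_spec {a : ℝ} {M : ℕ} (hM : 1 ≤ M) {t : ℝ} (ht0 : 0 ≤ t) (ht : t ≤ a) :
    1 ≤ blockIndex a M t ∧ blockIndex a M t ≤ M ∧ t ∈ dyadicBlock a M (blockIndex a M t) := by
  have hne : {m : ℕ | 1 ≤ m ∧ m ≤ M ∧ t ∈ dyadicBlock a M m}.Nonempty := by
    by_cases hlast : t ≤ a / 2 ^ (M - 1)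
    · exact ⟨M, hM, le_rfl, by simp [dyadicBlock, ht0, hlast]⟩
    push Not at hlast
    -- Outside the last interval, the block containing t is the least m with a / 2^m < t.
    -- Nonemptiness matters, since `sInf` of the empty set is 0.
    have hex : ∃ m : ℕ, a / 2 ^ m < t := ⟨M - 1, hlast⟩
    classical
    have hspec := Nat.find_spec hex
    have hmin := fun m => Nat.find_min hex (m := m)
    have hle : Nat.find hex ≤ M - 1 := Nat.find_min' hex hlast
    set n := Nat.find hex
    have hn0 : n ≠ 0 := by
      intro h0
      rw [h0] at hspec
      simp only [pow_zero, div_one] at hspec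
      linarith
    refine ⟨n, by omega, by omega, ?_⟩
    rw [dyadicBlock, if_neg (by omega)]
    exact ⟨hspec, not_lt.mp (hmin (n - 1) (by omega))⟩
  exact Nat.sInf_mem hne

theorem le_of_mem_dyadicBlock {a : ℝ} {M m : ℕ} {t : ℝ}
    (h : t ∈ dyadicBlock a M m) : t ≤ a / 2 ^ (m - 1) := by
  unfold dyadicBlock at h
  split_ifs at h with hm
  · rw [hm]; exact h.2
  · exact h.2

/-- For a discarded pair of blocks, the lower endpoints therefore multiply to at least log(1/ε). -/
theorem two_pow_le_of_lt_firstBlock {N : ℕ} (hN : 1 ≤ N) {ε : ℝ} (h0 : 0 < ε) (h1 : ε < 1)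
    {m l : ℕ} (hl : 1 ≤ l) (h : l < firstBlock (Real.log (1 / ε)) N ε m) :
    (2 : ℝ) ^ m * 2 ^ l ≤ N := by
  have hY : 0 < Real.log (1 / ε) := Real.log_pos (by rw [lt_div_iff₀ h0]; linarith)
  have hN' : (0 : ℝ) < N := by exact_mod_cast hN
  have h2 : (l : ℤ) ≤ ⌊Real.logb 2 (Real.log (1 / ε) * N) - m - Real.logb 2 (Real.log (1 / ε))⌋ := by
    unfold firstBlock at h; omega
  rw [Int.le_floor, Real.logb_mul hY.ne' hN'.ne'] at h2
  have h3 : ((m + l : ℕ) : ℝ) ≤ Real.logb 2 N := by push_cast at h2 ⊢; linarith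
  rw [Real.le_logb_iff_rpow_le (by norm_num) hN', Real.rpow_natCast, pow_add] at h3
  exact h3

/-- Replacing the kernel by 1 where yt ≤ ε nearly exhausts the error budget: only the second-order
slack of 1 - e^{-ε} ≤ ε - ε²/2 + 2ε³/9 is left for the transform, so its tolerance has to be of
order ε². -/
theorem one_sub_exp_neg_add_le {ε : ℝ} (h0 : 0 < ε) (h1 : ε < 1) :
    1 - Real.exp (-ε) + ε ^ 2 / 16 ≤ ε := by
  have h := Real.exp_bound (x := -ε) (by rw [abs_neg, abs_of_pos h0]; exact h1.le) (n := 3)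
    (by norm_num)
  have h2 := (abs_le.mp h).1
  simp only [sum_range_succ, range_zero, sum_empty, abs_neg, abs_of_pos h0] at h2
  norm_num [Nat.factorial] at h2
  nlinarith [mul_pos h0 h0, mul_pos (mul_pos h0 h0) (sub_pos.mpr h1)]

theorem abs_exp_neg_sub_one_add_le {ε t : ℝ} (h0 : 0 < ε) (h1 : ε < 1) (ht0 : 0 ≤ t)
    (ht : t ≤ ε) : |Real.exp (-t) - 1| + ε ^ 2 / 16 ≤ ε := by
  have h2 : Real.exp (-t) ≤ 1 := Real.exp_le_one_iff.mpr (by linarith)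
  have h3 : Real.exp (-ε) ≤ Real.exp (-t) := Real.exp_le_exp.mpr (by linarith)
  rw [abs_sub_comm, abs_of_nonneg (by linarith)]
  linarith [one_sub_exp_neg_add_le h0 h1]

/-- The weight of the `k`-th coefficient in the far field input with index `s` of band `m`. -/
noncomputable def farWeight (N : ℕ) (ε : ℝ) (m : ℕ) (s : Fin (laplaceRank ε)) (t : ℝ) : ℝ :=
  if firstBlock (Real.log (1 / ε)) N ε m ≤ blockIndex N (numBlocks N ε) t ∧
      blockIndex N (numBlocks N ε) t ≤ numBlocks N ε - m then
    ∑ r, Real.exp (-(blockNode (laplaceRank ε) (Real.log (1 / ε)) m s *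
        blockNode (laplaceRank ε) N (blockIndex N (numBlocks N ε) t) r)) *
      blockLagrange (laplaceRank ε) N (blockIndex N (numBlocks N ε) t) r t
  else 0

noncomputable def nearWeight (N : ℕ) (ε : ℝ) (m : ℕ) (t : ℝ) : ℝ :=
  if numBlocks N ε - m < blockIndex N (numBlocks N ε) t then 1 else 0

/-- The separable approximation of the Laplace kernel, together with the error caused by
the approximate Fourier transforms. -/
theorem kernel_error_le {N : ℕ} (hN : 1 ≤ N) {ε : ℝ} (h0 : 0 < ε) (h1 : ε < 1)
    {y : ℝ} (hy0 : 0 ≤ y) (hy : y ≤ Real.log (1 / ε))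
    (hlt : blockIndex (Real.log (1 / ε)) (numBlocks N ε) y < numBlocks N ε)
    {t : ℝ} (ht0 : 0 < t) (ht : t ≤ N) {m : ℕ}
    (hm : m = blockIndex (Real.log (1 / ε)) (numBlocks N ε) y) :
    |Real.exp (-(y * t)) - (nearWeight N ε m t +
        ∑ s, blockLagrange (laplaceRank ε) (Real.log (1 / ε)) m s y * farWeight N ε m s t)|
      + ε ^ 2 / 16 * (|nearWeight N ε m t| +
        ∑ s, |blockLagrange (laplaceRank ε) (Real.log (1 / ε)) m s y| * |farWeight N ε m s t|)
      ≤ ε := by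
  have hY : 0 < Real.log (1 / ε) := Real.log_pos (by rw [lt_div_iff₀ h0]; linarith)
  have hN' : (0 : ℝ) < N := by exact_mod_cast hN
  have hM := one_le_numBlocks N ε
  obtain ⟨hm1, -, hmem⟩ := blockIndex_spec hM hy0 hy
  obtain ⟨hl1, hlM, hlmem⟩ := blockIndex_spec hM ht0.le ht
  rw [← hm] at hlt hm1 hmem
  set l := blockIndex N (numBlocks N ε) t with hl
  have hbM := div_two_pow_numBlocks_le hN h0 h1
  have hyle := le_of_mem_dyadicBlock hmem
  have htle := le_of_mem_dyadicBlock hlmem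
  rw [dyadicBlock, if_neg hlt.ne] at hmem
  unfold nearWeight farWeight
  rw [← hl]
  -- Near field: m + l ≥ M + 1, so the upper endpoints multiply to at most N log(1/ε) / 2^{M-1} ≤ ε.
  -- Only upper endpoints are used, hence l = M is allowed.
  by_cases hnear : numBlocks N ε - m < l
  · have hfar : ¬ (firstBlock (Real.log (1 / ε)) N ε m ≤ l ∧ l ≤ numBlocks N ε - m) := by
      rintro ⟨-, h⟩
      exact absurd hnear (not_lt.mpr h)
    simp only [if_pos hnear, if_neg hfar, mul_zero, sum_const_zero, add_zero, abs_one, mul_one, abs_zero]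
    refine abs_exp_neg_sub_one_add_le h0 h1 (by positivity) (le_trans ?_ hbM)
    calc y * t ≤ (Real.log (1 / ε) / 2 ^ (m - 1)) * (N / 2 ^ (l - 1)) := by gcongr
      _ = N * Real.log (1 / ε) / 2 ^ (m - 1 + (l - 1)) := by rw [pow_add]; field_simp
      _ ≤ N * Real.log (1 / ε) / 2 ^ (numBlocks N ε - 1) := by
        gcongr
        · norm_num
        · omega
  rw [if_neg hnear]
  have hlne : l ≠ numBlocks N ε := by omega
  rw [dyadicBlock, if_neg hlne] at hlmem
  by_cases hfar : firstBlock (Real.log (1 / ε)) N ε m ≤ l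
  · have hc : firstBlock (Real.log (1 / ε)) N ε m ≤ l ∧ l ≤ numBlocks N ε - m := ⟨hfar, by omega⟩
    simp only [if_pos hc, zero_add, abs_zero]
    have hy' := Set.Ioc_subset_Icc_self hmem
    have ht' := Set.Ioc_subset_Icc_self hlmem
    have e1 := abs_exp_sub_blockInterpolate_le h0 h1 hY hN' hm1 hl1 hy' ht'
    have hq := one_le_laplaceRank h0 h1
    have e2 := laplaceRank_mul_le h0 h1
    have e3 := sum_abs_blockLagrange_le hq hY hm1 hy'
    have e4 := sum_abs_blockLagrange_le hq hN' hl1 ht'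
    have hq' : (1 : ℝ) ≤ laplaceRank ε := by exact_mod_cast hq
    have e5 : ∀ s, |∑ r, Real.exp (-(blockNode (laplaceRank ε) (Real.log (1 / ε)) m s *
        blockNode (laplaceRank ε) N l r)) * blockLagrange (laplaceRank ε) N l r t|
        ≤ √(2 * laplaceRank ε - 1) := by
      intro s
      refine ((abs_sum_le_sum_abs _ _).trans (sum_le_sum fun r _ => ?_)).trans e4
      rw [abs_mul, Real.abs_exp]
      refine mul_le_of_le_one_left (abs_nonneg _) (Real.exp_le_one_iff.mpr ?_)
      have := mul_nonneg (blockNode_nonneg hY hm1 s) (blockNode_nonneg hN' hl1 r)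
      linarith
    have e6 : ∑ s, |blockLagrange (laplaceRank ε) (Real.log (1 / ε)) m s y| *
        |∑ r, Real.exp (-(blockNode (laplaceRank ε) (Real.log (1 / ε)) m s *
        blockNode (laplaceRank ε) N l r)) * blockLagrange (laplaceRank ε) N l r t|
        ≤ 2 * laplaceRank ε - 1 := by
      calc _ ≤ ∑ s, |blockLagrange (laplaceRank ε) (Real.log (1 / ε)) m s y| *
            √(2 * laplaceRank ε - 1) :=
            sum_le_sum fun s _ => mul_le_mul_of_nonneg_left (e5 s) (abs_nonneg _)
        _ ≤ √(2 * laplaceRank ε - 1) * √(2 * laplaceRank ε - 1) := by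
          rw [← sum_mul]; gcongr
        _ = _ := Real.mul_self_sqrt (by linarith)
    -- Interpolation costs 4ε/5, and the transforms cost (ε²/16)(2q - 1) ≤ ε/8.
    nlinarith
  · simp only [if_neg (fun h : _ ∧ _ => hfar h.1), mul_zero, sum_const_zero, add_zero, abs_zero, sub_zero, Real.abs_exp]
    -- Both weights vanish here, so no transform error enters and the whole budget ε covers the
    -- discarded kernel.
    have h2 := two_pow_le_of_lt_firstBlock hN h0 h1 hl1 (not_le.mp hfar)
    have h3 : Real.log (1 / ε) ≤ y * t := by
      calc Real.log (1 / ε) ≤ Real.log (1 / ε) * (N / (2 ^ m * 2 ^ l)) := by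
            refine le_mul_of_one_le_right hY.le ?_
            rwa [one_le_div (by positivity)]
        _ = Real.log (1 / ε) / 2 ^ m * (N / 2 ^ l) := by field_simp
        _ ≤ y * t := by
          have := hmem.1.le
          have := hlmem.1.le
          gcongr
    calc Real.exp (-(y * t)) ≤ Real.exp (-Real.log (1 / ε)) := Real.exp_le_exp.mpr (by linarith)
      _ = ε := by rw [one_div, Real.log_inv, neg_neg, Real.exp_log h0]

/-- Reduces accuracy to the scalar condition `hκ` for each coefficient: the kernel error plus δ
times the total weight through which transform errors enter. -/
theorem norm_separable_sub_le {N : ℕ} {δ ε : ℝ} {ι : Type} [Fintype ι]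
    (fhat e : Fin N → ℂ) (κ g : Fin N → ℝ) (a : ι → ℝ) (w : ι → Fin N → ℝ) (G : ℂ) (H : ι → ℂ)
    (he : ∀ k, ‖e k‖ = 1)
    (hG : ‖G - ∑ k, e k * (g k * fhat k)‖ ≤ δ * ∑ k, ‖(g k : ℂ) * fhat k‖)
    (hH : ∀ s, ‖H s - ∑ k, e k * (w s k * fhat k)‖ ≤ δ * ∑ k, ‖(w s k : ℂ) * fhat k‖)
    (hκ : ∀ k, |κ k - (g k + ∑ s, a s * w s k)| + δ * (|g k| + ∑ s, |a s| * |w s k|) ≤ ε) :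
    ‖∑ k, κ k * e k * fhat k - (G + ∑ s, a s * H s)‖ ≤ ε * ∑ k, ‖fhat k‖ := by
  have split : ∑ k, κ k * e k * fhat k - (G + ∑ s, a s * H s)
      = ∑ k, ((κ k - (g k + ∑ s, a s * w s k) : ℝ) : ℂ) * e k * fhat k
        - (G - ∑ k, e k * (g k * fhat k))
        - ∑ s, a s * (H s - ∑ k, e k * (w s k * fhat k)) := by
    have h1 : ∀ k, ((κ k - (g k + ∑ s, a s * w s k) : ℝ) : ℂ) * e k * fhat k
        = κ k * e k * fhat k - e k * (g k * fhat k) - ∑ s, a s * (e k * (w s k * fhat k)) := by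
      intro k
      push_cast
      rw [sub_mul, sub_mul, add_mul, add_mul, sum_mul, sum_mul, ← sub_sub]
      congr 1
      · ring
      · exact sum_congr rfl fun s _ => by ring
    simp only [h1, sum_sub_distrib, mul_sub]
    rw [sum_comm (s := (univ : Finset (Fin N)))]
    simp only [mul_sum]
    ring
  rw [split]
  refine (norm_sub_le _ _).trans ?_
  have b1 : ‖∑ k, ((κ k - (g k + ∑ s, a s * w s k) : ℝ) : ℂ) * e k * fhat k‖
      ≤ ∑ k, |κ k - (g k + ∑ s, a s * w s k)| * ‖fhat k‖ := by
    refine (norm_sum_le _ _).trans (le_of_eq (sum_congr rfl fun k _ => ?_))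
    rw [norm_mul, norm_mul, he, mul_one, Complex.norm_real, Real.norm_eq_abs]
  have b2 : ‖G - ∑ k, e k * (g k * fhat k)‖ ≤ ∑ k, δ * |g k| * ‖fhat k‖ := by
    refine hG.trans (le_of_eq ?_)
    rw [mul_sum]
    refine sum_congr rfl fun k _ => ?_
    rw [norm_mul, Complex.norm_real, Real.norm_eq_abs, mul_assoc]
  have b3 : ‖∑ s, a s * (H s - ∑ k, e k * (w s k * fhat k))‖
      ≤ ∑ k, δ * (∑ s, |a s| * |w s k|) * ‖fhat k‖ := by
    calc _ ≤ ∑ s, |a s| * (δ * ∑ k, ‖(w s k : ℂ) * fhat k‖) := by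
          refine (norm_sum_le _ _).trans (sum_le_sum fun s _ => ?_)
          rw [norm_mul, Complex.norm_real, Real.norm_eq_abs]
          exact mul_le_mul_of_nonneg_left (hH s) (abs_nonneg _)
      _ = _ := by
          simp only [mul_sum, sum_mul]
          rw [sum_comm]
          refine sum_congr rfl fun k _ => sum_congr rfl fun s _ => ?_
          rw [norm_mul, Complex.norm_real, Real.norm_eq_abs]; ring
  refine (add_le_add ((norm_sub_le _ _).trans (add_le_add b1 b2)) b3).trans ?_
  rw [← sum_add_distrib, ← sum_add_distrib, mul_sum]
  refine sum_le_sum fun k _ => ?_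
  rw [← add_mul, ← add_mul]
  refine mul_le_mul_of_nonneg_right ?_ (norm_nonneg _)
  linarith [hκ k]

/-- Passing to the fractional part changes the phase by n times an integer, which is harmless
because the exponent n is an integer. -/
theorem pow_eq_exp_mul_cis {z : ℂ} (hz : z ≠ 0) (n : ℕ) :
    z ^ n = (Real.exp (-(-Real.log ‖z‖ * n)) : ℂ) *
      cis (n * Int.fract (Complex.arg z / (2 * Real.pi))) := by
  have h1 : cis (n * Int.fract (Complex.arg z / (2 * Real.pi)))
      = cis (n * (Complex.arg z / (2 * Real.pi))) := by
    rw [← cis_add_int _ (n * ⌊Complex.arg z / (2 * Real.pi)⌋)]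
    congr 1
    push_cast
    rw [← mul_add, Int.fract_add_floor]
  have hpi : (Real.pi : ℂ) ≠ 0 := by exact_mod_cast Real.pi_ne_zero
  rw [h1, cis]
  have h2 : z = Complex.exp (Complex.log z) := (Complex.exp_log hz).symm
  conv_lhs => rw [h2]
  rw [← Complex.exp_nat_mul, Complex.ofReal_exp, ← Complex.exp_add]
  congr 1
  rw [Complex.log]
  push_cast
  field_simp

/-- The membership tests come from the zero padding of `Flops.forEach`. -/
theorem unitDiskEval_val (F : FourierMethod) (N : ℕ) (ε : ℝ) (ξ : Fin N → ℝ) (z fhat : Fin N → ℂ)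
    (j : Fin N) :
    (unitDiskEval F N ε ξ z fhat).val j =
      let M := numBlocks N ε
      let q := laplaceRank ε
      let x : Fin N → ℝ := fun j => Int.fract (Complex.arg (z j) / (2 * Real.pi))
      let y : Fin N → ℝ := fun j => -Real.log ‖z j‖
      let y₁ := Real.log (1 / ε)
      let band : Fin N → ℕ := fun j => blockIndex y₁ M (y j)
      let block : Fin N → ℕ := fun k => blockIndex N M (ξ k)
      let A := F N (ε ^ 2 / 16) x ξ
      if ‖z j‖ < ε then 0
      else if band j = M then (A fhat).val j
      else if band j ∈ Icc 1 (M - 1) then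
        if j ∈ univ.filter (fun i => ε ≤ ‖z i‖ ∧ band i = band j) then
          (A fun k => if M - band j < block k then fhat k else 0).val j +
            ∑ s : Fin q, (blockLagrange q y₁ (band j) s (y j) : ℂ) *
              (if s ∈ univ then (A fun k =>
                (if k ∈ univ.filter (fun k => firstBlock y₁ N ε (band j) ≤ block k ∧
                    block k ≤ M - band j) then
                  fun s : Fin q => if s ∈ univ then ∑ r : Fin q,
                    (Real.exp (-(blockNode q y₁ (band j) s * blockNode q N (block k) r)) : ℂ) *
                    (if k ∈ univ.filter (fun k => block k < M) then
                      fun r : Fin q => if r ∈ univ then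
                        fhat k * (blockLagrange q N (block k) r (ξ k) : ℂ) else 0
                    else 0) r
                  else 0
                else 0) s).val else 0) j
        else 0
      else 0 := by
  simp only [unitDiskEval]
  by_cases h1 : ‖z j‖ < ε
  · simp [bind, pure, h1]
  by_cases h2 : blockIndex (Real.log (1 / ε)) (numBlocks N ε) (-Real.log ‖z j‖) = numBlocks N ε
  · simp only [bind, pure, if_neg h1, if_pos h2]
  by_cases h3 : blockIndex (Real.log (1 / ε)) (numBlocks N ε) (-Real.log ‖z j‖) ∈
    Icc 1 (numBlocks N ε - 1)
  · simp only [bind, pure, if_neg h1, if_neg h2, if_pos h3, Flops.forEach]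
    rfl
  · simp only [bind, pure, if_neg h1, if_neg h2, if_neg h3, Flops.forEach]
    rfl

theorem norm_eval_sub_le {F : FourierMethod} {N : ℕ} (hN : 1 ≤ N) {ε : ℝ} (h0 : 0 < ε) (h1 : ε < 1)
    (z fhat : Fin N → ℂ) (hz : ∀ j, ‖z j‖ ≤ 1)
    (hF : F.IsAccurate N (ε ^ 2 / 16) (fun j => Int.fract (Complex.arg (z j) / (2 * Real.pi)))
      fun k => (k : ℝ) + 1) :
    ‖(powerMatrix N z).mulVec fhat - (polyEval F N ε z fhat).val‖ ≤ ε * ∑ k, ‖fhat k‖ := by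
  rw [pi_norm_le_iff_of_nonneg (by positivity)]
  intro j
  have hf : (powerMatrix N z).mulVec fhat j = ∑ k : Fin N, z j ^ ((k : ℕ) + 1) * fhat k := rfl
  rw [Pi.sub_apply, hf, polyEval, unitDiskEval_val]
  let M := numBlocks N ε
  let q := laplaceRank ε
  let x : Fin N → ℝ := fun j => Int.fract (Complex.arg (z j) / (2 * Real.pi))
  let y : Fin N → ℝ := fun j => -Real.log ‖z j‖
  let y₁ := Real.log (1 / ε)
  let band : Fin N → ℕ := fun j => blockIndex y₁ M (y j)
  let block : Fin N → ℕ := fun k => blockIndex N M ((k : ℝ) + 1)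
  let A := F N (ε ^ 2 / 16) x fun k => (k : ℝ) + 1
  dsimp only
  -- All exponents are at least 1, so |z|^k ≤ |z| < ε and the output 0 is accurate enough.
  by_cases hzε : ‖z j‖ < ε
  · rw [if_pos hzε, sub_zero, mul_sum]
    refine (norm_sum_le _ _).trans (sum_le_sum fun k _ => ?_)
    rw [norm_mul, norm_pow, pow_succ]
    refine mul_le_mul_of_nonneg_right ?_ (norm_nonneg _)
    calc ‖z j‖ ^ (k : ℕ) * ‖z j‖ ≤ 1 * ε := by
          gcongr
          exact pow_le_one₀ (norm_nonneg _) (hz j)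
      _ = ε := one_mul _
  rw [if_neg hzε]
  push Not at hzε
  have hz0 : z j ≠ 0 := by rw [← norm_pos_iff]; linarith
  have hy0 : 0 ≤ y j := neg_nonneg.mpr (Real.log_nonpos (norm_nonneg _) (hz j))
  have hy1 : y j ≤ y₁ := by
    simp only [y, y₁, one_div, Real.log_inv]
    exact neg_le_neg (Real.log_le_log h0 hzε)
  have hM := one_le_numBlocks N ε
  obtain ⟨hb1, hbM, hbmem⟩ := blockIndex_spec hM hy0 hy1
  have hpow : ∀ k : Fin N, z j ^ ((k : ℕ) + 1)
      = (Real.exp (-(y j * ((k : ℝ) + 1))) : ℂ) * cis (((k : ℝ) + 1) * x j) := by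
    intro k
    rw [pow_eq_exp_mul_cis hz0, Nat.cast_add, Nat.cast_one]
  have ht0 : ∀ k : Fin N, (0 : ℝ) < (k : ℝ) + 1 := fun k => by positivity
  have htN : ∀ k : Fin N, ((k : ℕ) : ℝ) + 1 ≤ N := fun k => by exact_mod_cast k.2
  simp only [hpow]
  by_cases hband : band j = M
  · rw [if_pos hband]
    -- In the innermost band yt ≤ ε for every frequency: the near field is everything, and the
    -- far-field index type is empty.
    have key := norm_separable_sub_le (ι := Empty) (ε := ε) (δ := ε ^ 2 / 16) fhat
      (fun k => cis (((k : ℝ) + 1) * x j)) (fun k => Real.exp (-(y j * ((k : ℝ) + 1))))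
      (fun _ => 1) (fun _ => 0) (fun _ _ => 0) ((A fhat).val j) (fun _ => 0)
      (fun k => norm_cis _) (by simpa using hF fhat j) (fun s => s.elim) (by
        intro k
        simp only [univ_eq_empty, sum_empty, add_zero, abs_one, mul_one]
        refine abs_exp_neg_sub_one_add_le h0 h1 (mul_nonneg hy0 (ht0 k).le)
          (le_trans ?_ (div_two_pow_numBlocks_le hN h0 h1))
        have h2 := le_of_mem_dyadicBlock hbmem
        rw [show blockIndex y₁ (numBlocks N ε) (y j) = numBlocks N ε from hband] at h2
        have h3 := htN k
        have h4 := (ht0 k).le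
        have h5 : 0 ≤ y₁ / 2 ^ (numBlocks N ε - 1) := div_nonneg (hy0.trans hy1) (by positivity)
        calc y j * ((k : ℝ) + 1) ≤ y₁ / 2 ^ (numBlocks N ε - 1) * N := by gcongr
          _ = _ := by ring)
    simpa using key
  rw [if_neg hband]
  have hlt : band j < M := lt_of_le_of_ne hbM hband
  rw [if_pos (mem_Icc.mpr ⟨hb1, Nat.le_sub_one_of_lt hlt⟩), if_pos (by simp [hzε])]
  refine norm_separable_sub_le (ε := ε) (δ := ε ^ 2 / 16) fhat
      (fun k => cis (((k : ℝ) + 1) * x j)) (fun k => Real.exp (-(y j * ((k : ℝ) + 1))))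
      (fun k => nearWeight N ε (band j) ((k : ℝ) + 1))
      (fun s => blockLagrange q y₁ (band j) s (y j))
      (fun s k => farWeight N ε (band j) s ((k : ℝ) + 1)) _ _
      (fun k => norm_cis _) ?_ ?_ ?_
  · have : (fun k => if M - band j < block k then fhat k else 0)
        = fun k : Fin N => (nearWeight N ε (band j) ((k : ℝ) + 1) : ℂ) * fhat k := by
      funext k
      change _ = (((if M - band j < block k then (1 : ℝ) else 0) : ℝ) : ℂ) * fhat k
      split_ifs <;> simp
    rw [this]
    exact hF _ j
  · intro s
    rw [if_pos (mem_univ s)]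
    have : ∀ c c' : Fin N → ℂ, c = c' → ‖(A c).val j - ∑ k : Fin N, cis (((k : ℝ) + 1) * x j) * c' k‖
        ≤ ε ^ 2 / 16 * ∑ k, ‖c' k‖ := by
      rintro c _ rfl
      exact hF c j
    refine this _ (fun k => (farWeight N ε (band j) s ((k : ℝ) + 1) : ℂ) * fhat k) ?_
    funext k
    change _ = (((if firstBlock y₁ N ε (band j) ≤ block k ∧ block k ≤ M - band j then
      ∑ r, Real.exp (-(blockNode q y₁ (band j) s * blockNode q N (block k) r)) *
        blockLagrange q N (block k) r ((k : ℝ) + 1) else 0) : ℝ) : ℂ) * fhat k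
    by_cases hc : firstBlock y₁ N ε (band j) ≤ block k ∧ block k ≤ M - band j
    · have hc' : block k < M := hc.2.trans_lt (Nat.sub_lt hM hb1)
      rw [if_pos (mem_filter.mpr ⟨mem_univ k, hc⟩), if_pos hc,
        if_pos (mem_filter.mpr ⟨mem_univ k, hc'⟩)]
      simp only [mem_univ, if_true]
      push_cast
      rw [sum_mul]
      exact sum_congr rfl fun r _ => by ring
    · have hc' : k ∉ univ.filter fun k => firstBlock y₁ N ε (band j) ≤ block k ∧
          block k ≤ M - band j := fun h => hc (mem_filter.mp h).2
      rw [if_neg hc, if_neg hc']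
      simp
  · intro k
    exact kernel_error_le hN h0 h1 hy0 hy1 hlt (ht0 k) (htN k) rfl

end

end DiskEval

namespace DiskEval

section

open Finset

/-! ### Gaussian windows -/

theorem window_pos (β t : ℝ) : 0 < window β t := Real.exp_pos _

theorem windowHat_nonneg (β θ : ℝ) : 0 ≤ windowHat β θ :=
  mul_nonneg (Real.sqrt_nonneg _) (Real.exp_pos _).le

/-- Up to the factor e^{-πη²/β} these are the terms of a Jacobi theta series with τ = i/β. -/
theorem summable_window_mul_cis {β : ℝ} (hβ : 0 < β) (η θ : ℝ) :
    Summable fun t : ℤ => (window β (η - t) : ℂ) * cis (t * θ) := by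
  have h := (summable_jacobiTheta₂_term_iff (θ - Complex.I * (η / β)) (Complex.I / β)).mpr (by
    have : Complex.I / (β : ℂ) = ((1 / β : ℝ) : ℂ) * Complex.I := by push_cast; ring
    rw [this, Complex.im_ofReal_mul, Complex.I_im]; positivity)
  have hβ' : (β : ℂ) ≠ 0 := by exact_mod_cast hβ.ne'
  refine (h.mul_left (Complex.exp (-Real.pi * η ^ 2 / β))).congr fun t => ?_
  rw [jacobiTheta₂_term, window, cis, Complex.ofReal_exp, ← Complex.exp_add, ← Complex.exp_add]
  congr 1
  push_cast
  field_simp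
  linear_combination (-2 * (t : ℂ) * η + (t : ℂ) ^ 2) * Complex.I_sq

theorem summable_window {β : ℝ} (hβ : 0 < β) (η : ℝ) :
    Summable fun t : ℤ => window β (η - t) := by
  refine (summable_window_mul_cis hβ η 0).norm.congr fun t => ?_
  rw [norm_mul, norm_cis, mul_one, Complex.norm_real, Real.norm_of_nonneg (window_pos _ _).le]

/-- Poisson summation for the Gaussian window. -/
theorem tsum_window_mul_cis {β : ℝ} (hβ : 0 < β) (η θ : ℝ) :
    ∑' t : ℤ, (window β (η - t) : ℂ) * cis (t * θ)
      = ∑' m : ℤ, (windowHat β (θ - m) : ℂ) * cis (η * (θ - m)) := by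
  have hβ' : (β : ℂ) ≠ 0 := by exact_mod_cast hβ.ne'
  have h := Complex.tsum_exp_neg_quadratic (a := ((1 / β : ℝ) : ℂ))
    (by rw [Complex.ofReal_re]; positivity) (η / β + θ * Complex.I)
  have hs : 1 / (((1 / β : ℝ) : ℂ)) ^ (1 / 2 : ℂ) = (√β : ℂ) := by
    have : ((1 / 2 : ℝ) : ℂ) = (1 / 2 : ℂ) := by push_cast; ring
    rw [← this, ← Complex.ofReal_cpow (by positivity), ← Real.sqrt_eq_rpow, one_div β, Real.sqrt_inv]
    push_cast
    rw [one_div, inv_inv]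
  rw [hs] at h
  have e1 : ∀ t : ℤ, (window β (η - t) : ℂ) * cis (t * θ) = Complex.exp (-Real.pi * η ^ 2 / β) *
      Complex.exp (-Real.pi * ((1 / β : ℝ) : ℂ) * t ^ 2
        + 2 * Real.pi * (η / β + θ * Complex.I) * t) := by
    intro t
    rw [window, cis, Complex.ofReal_exp, ← Complex.exp_add, ← Complex.exp_add]
    congr 1
    push_cast
    field_simp
    ring
  have e2 : ∀ m : ℤ, (windowHat β (θ - m) : ℂ) * cis (η * (θ - m)) =
      Complex.exp (-Real.pi * η ^ 2 / β) * (√β *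
      Complex.exp (-Real.pi / ((1 / β : ℝ) : ℂ) *
        (m + Complex.I * (η / β + θ * Complex.I)) ^ 2)) := by
    intro m
    rw [windowHat, cis, Complex.ofReal_mul, Complex.ofReal_exp, mul_assoc, ← Complex.exp_add,
      mul_left_comm, ← Complex.exp_add]
    congr 2
    push_cast
    field_simp
    linear_combination (η ^ 2 + 2 * η * β * θ * Complex.I
      + β ^ 2 * θ ^ 2 * (Complex.I ^ 2 - 1) + 2 * (m : ℂ) * θ * β ^ 2) * Complex.I_sq
  simp only [e1, e2, tsum_mul_left]
  rw [h]

/-- Here 9/16 = (3/4)² is the squared distance from [-1/4, 1/4] to the nonzero integers; the bound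
controls the ratio of the geometric series of aliases. -/
theorem exp_neg_mul_pi_le {β : ℝ} (hβ : 10 ≤ β) : Real.exp (-Real.pi * β * (9 / 16)) ≤ 1 / 16 := by
  have hpi := Real.pi_gt_three
  have h := Real.add_one_le_exp (Real.pi * β * (9 / 16))
  have : -Real.pi * β * (9 / 16) = -(Real.pi * β * (9 / 16)) := by ring
  rw [this, Real.exp_neg, ← one_div]
  apply one_div_le_one_div_of_le (by norm_num)
  nlinarith

/-- After Poisson summation the term m = 0 is the desired exponential and the others are aliases. As
(|m| - 1/4)² ≥ (9/16)|m|, geometric series dominate them on both sides. -/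
theorem norm_tsum_window_mul_cis_sub_le {β : ℝ} (hβ : 10 ≤ β) (η : ℝ) {θ : ℝ} (hθ : |θ| ≤ 1 / 4) :
    ‖∑' t : ℤ, (window β (η - t) : ℂ) * cis (t * θ) - windowHat β θ * cis (η * θ)‖
      ≤ 4 * √β * Real.exp (-Real.pi * β * (9 / 16)) := by
  set r := Real.exp (-Real.pi * β * (9 / 16)) with hr
  have hr1 := exp_neg_mul_pi_le hβ
  rw [← hr] at hr1
  have hr0 : 0 < r := Real.exp_pos _
  have hgeom : HasSum (fun n : ℕ => √β * r ^ (n + 1)) (√β * (r * (1 - r)⁻¹)) := by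
    simp only [pow_succ']
    exact ((hasSum_geometric_of_lt_one hr0.le (by linarith)).mul_left r).mul_left _
  have hle : √β * (r * (1 - r)⁻¹) ≤ 2 * √β * r := by
    have : (1 - r)⁻¹ ≤ 2 := by
      rw [inv_le_comm₀ (by linarith) (by norm_num)]; linarith
    calc √β * (r * (1 - r)⁻¹) ≤ √β * (r * 2) := by gcongr
      _ = _ := by ring
  set F : ℤ → ℂ := fun m => (windowHat β (θ - m) : ℂ) * cis (η * (θ - m)) with hF
  have hbound : ∀ (n : ℕ) (m : ℤ), (|m| = n + 1) → ‖F m‖ ≤ √β * r ^ (n + 1) := by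
    intro n m hm
    rw [hF, norm_mul, norm_cis, mul_one, Complex.norm_real, Real.norm_of_nonneg
      (windowHat_nonneg _ _), windowHat, hr, ← Real.exp_nat_mul]
    refine mul_le_mul_of_nonneg_left (Real.exp_le_exp.mpr ?_) (Real.sqrt_nonneg _)
    have hm' : |(m : ℝ)| = n + 1 := by exact_mod_cast congrArg (Int.cast : ℤ → ℝ) hm
    have h1 : (n : ℝ) + 3 / 4 ≤ |θ - m| := by
      have := abs_sub_abs_le_abs_sub (m : ℝ) θ
      rw [abs_sub_comm] at this
      linarith
    have h2 : ((n : ℝ) + 3 / 4) ^ 2 ≤ (θ - m) ^ 2 := by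
      rw [← sq_abs (θ - m)]
      exact pow_le_pow_left₀ (by positivity) h1 2
    have h3 : (9 / 16 : ℝ) * (n + 1) ≤ (θ - m) ^ 2 := by
      have : (0 : ℝ) ≤ n := by positivity
      nlinarith
    have h4 : 0 < Real.pi * β := by have := Real.pi_pos; positivity
    push_cast
    nlinarith
  have hb1 : ∀ n : ℕ, ‖F (n + 1)‖ ≤ √β * r ^ (n + 1) := fun n =>
    hbound n _ (by rw [abs_of_nonneg]; positivity)
  have hb2 : ∀ n : ℕ, ‖F (-(n + 1))‖ ≤ √β * r ^ (n + 1) := fun n =>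
    hbound n _ (by rw [abs_neg, abs_of_nonneg]; positivity)
  rw [tsum_window_mul_cis (by linarith), tsum_of_add_one_of_neg_add_one
    (f := F) (hgeom.summable.of_norm_bounded hb1) (hgeom.summable.of_norm_bounded hb2)]
  have hF0 : F 0 = windowHat β θ * cis (η * θ) := by simp [hF]
  rw [← hF0, add_right_comm, add_sub_cancel_right]
  refine (norm_add_le _ _).trans ?_
  have h1 := tsum_of_norm_bounded hgeom hb1
  have h2 := tsum_of_norm_bounded hgeom hb2
  linarith

theorem tsum_window_le {β : ℝ} (hβ : 10 ≤ β) (η : ℝ) : ∑' t : ℤ, window β (η - t) ≤ 2 * √β := by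
  have h := norm_tsum_window_mul_cis_sub_le hβ η (θ := 0) (by norm_num)
  have h1 : ∑' t : ℤ, (window β (η - t) : ℂ) * cis (t * 0) = ((∑' t : ℤ, window β (η - t) : ℝ) : ℂ) := by
    rw [Complex.ofReal_tsum]
    congr 1; funext t
    simp [cis]
  have h2 : (windowHat β 0 : ℂ) * cis (η * 0) = ((√β : ℝ) : ℂ) := by simp [windowHat, cis]
  rw [h1, h2, ← Complex.ofReal_sub, Complex.norm_real, Real.norm_eq_abs] at h
  have h3 := (abs_le.mp h).2
  have h4 := exp_neg_mul_pi_le hβ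
  have h5 := Real.sqrt_nonneg β
  nlinarith

theorem sum_window_le {β : ℝ} (hβ : 10 ≤ β) (η : ℝ) (T : Finset ℤ) :
    ∑ t ∈ T, window β (η - t) ≤ 2 * √β :=
  ((summable_window (by linarith) η).sum_le_tsum T fun _ _ => (window_pos _ _).le).trans
    (tsum_window_le hβ η)

/-- Half of the exponent is spent on decay at the cut-off; the other half remains as a wider window,
so the tail is still summable. -/
theorem window_le_of_abs_gt {β t : ℝ} (hβ : 0 < β) (ht : β ≤ |t|) :
    window β t ≤ Real.exp (-Real.pi * β / 2) * window (2 * β) t := by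
  rw [window, window, ← Real.exp_add]
  apply Real.exp_le_exp.mpr
  have h1 : β ^ 2 ≤ t ^ 2 := by rw [← sq_abs t]; exact pow_le_pow_left₀ hβ.le ht 2
  have hpi := Real.pi_pos
  have h2 : -Real.pi * β / 2 = -Real.pi * β ^ 2 / (2 * β) := by field_simp
  have h3 : -Real.pi * t ^ 2 / β = 2 * (-Real.pi * t ^ 2) / (2 * β) := by field_simp
  rw [h2, h3, ← add_div]
  gcongr
  nlinarith

/-- The sum over a truncated Gaussian window reproduces exponentials. -/
theorem norm_sum_window_mul_cis_sub_le {β : ℝ} (hβ : 10 ≤ β) (η : ℝ) {θ : ℝ} (hθ : |θ| ≤ 1 / 4) :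
    ‖∑ t ∈ Icc ⌈η - β⌉ ⌊η + β⌋, (window β (η - t) : ℂ) * cis (t * θ)
        - windowHat β θ * cis (η * θ)‖
      ≤ 7 * √β * Real.exp (-Real.pi * β / 2) := by
  have hβ0 : 0 < β := by linarith
  set T := Icc ⌈η - β⌉ ⌊η + β⌋ with hT
  set f : ℤ → ℂ := fun t => (window β (η - t) : ℂ) * cis (t * θ) with hf
  have hfs : Summable f := summable_window_mul_cis hβ0 η θ
  set h : ℤ → ℂ := fun t => if t ∈ T then f t else 0 with hh
  have hhs : Summable h := summable_of_ne_finset_zero (s := T) fun t ht => by simp [hh, ht]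
  have e1 : ∑ t ∈ T, f t = ∑' t, h t := by
    rw [tsum_eq_sum (s := T) fun t ht => by simp [hh, ht]]
    exact sum_congr rfl fun t ht => by simp [hh, ht]
  have e2 : ‖∑' t, (f t - h t)‖ ≤ Real.exp (-Real.pi * β / 2) * ∑' t : ℤ, window (2 * β) (η - t) := by
    refine tsum_of_norm_bounded
      (((summable_window (by linarith : 0 < 2 * β) η).hasSum).mul_left _) fun t => ?_
    by_cases ht : t ∈ T
    · simp only [hh, ht, if_true, sub_self, norm_zero]
      exact mul_nonneg (Real.exp_pos _).le (window_pos _ _).le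
    · simp only [hh, ht, if_false, sub_zero, hf, norm_mul, norm_cis, mul_one, Complex.norm_real]
      rw [Real.norm_of_nonneg (window_pos _ _).le]
      refine window_le_of_abs_gt hβ0 ?_
      by_contra hlt
      push Not at hlt
      rw [abs_lt] at hlt
      exact ht (mem_Icc.mpr ⟨Int.ceil_le.mpr (by linarith), Int.le_floor.mpr (by linarith)⟩)
  have e3 := tsum_window_le (by linarith : 10 ≤ 2 * β) η
  have e4 := norm_tsum_window_mul_cis_sub_le hβ η hθ
  have e5 : √(2 * β) ≤ 3 / 2 * √β := by
    rw [Real.sqrt_le_left (by positivity), mul_pow, Real.sq_sqrt hβ0.le]; linarith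
  have e6 : Real.exp (-Real.pi * β * (9 / 16)) ≤ Real.exp (-Real.pi * β / 2) :=
    Real.exp_le_exp.mpr (by nlinarith [mul_pos Real.pi_pos hβ0])
  have e7 : ∑ t ∈ T, f t - windowHat β θ * cis (η * θ)
      = (∑' t, f t - windowHat β θ * cis (η * θ)) - ∑' t, (f t - h t) := by
    rw [hfs.tsum_sub hhs, e1]; ring
  rw [e7]
  refine (norm_sub_le _ _).trans ?_
  -- Truncation contributes 2√(2β) ≤ 3√β and aliasing 4√β, whence the constant 7.
  have e8 : Real.exp (-Real.pi * β / 2) * ∑' t : ℤ, window (2 * β) (η - t)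
      ≤ Real.exp (-Real.pi * β / 2) * (2 * (3 / 2 * √β)) := by
    gcongr; linarith
  have e9 : 4 * √β * Real.exp (-Real.pi * β * (9 / 16)) ≤ 4 * √β * Real.exp (-Real.pi * β / 2) := by
    gcongr
  linarith

theorem inv_windowHat_le {β θ : ℝ} (hβ : 0 < β) (hθ : |θ| ≤ 1 / 4) :
    (windowHat β θ)⁻¹ ≤ Real.exp (Real.pi * β / 16) / √β := by
  have h1 : θ ^ 2 ≤ 1 / 16 := by
    rw [← sq_abs]; nlinarith [abs_nonneg θ]
  have h2 : √β * Real.exp (-(Real.pi * β / 16)) ≤ windowHat β θ := by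
    rw [windowHat]
    refine mul_le_mul_of_nonneg_left (Real.exp_le_exp.mpr ?_) (Real.sqrt_nonneg _)
    nlinarith [mul_pos Real.pi_pos hβ]
  have h3 : 0 < √β := Real.sqrt_pos.mpr hβ
  refine (inv_anti₀ (by positivity) h2).trans (le_of_eq ?_)
  rw [Real.exp_neg]
  field_simp

/-- Two successive truncated Gaussian sums with deconvolution reproduce exponentials. -/
theorem norm_double_window_sub_le {β : ℝ} (hβ : 10 ≤ β) {P η θ : ℝ} (hP : 0 < P)
    (hη : 4 * (|η| + β) ≤ P) (hθ : |θ| ≤ 1 / 4) :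
    ‖((windowHat β θ)⁻¹ : ℂ) * ∑ t ∈ Icc ⌈η - β⌉ ⌊η + β⌋, (window β (η - t) : ℂ) *
        (((windowHat β (t / P))⁻¹ : ℂ) *
          ∑ l ∈ Icc ⌈P * θ - β⌉ ⌊P * θ + β⌋, (window β (P * θ - l) : ℂ) * cis (l * (t / P)))
        - cis (η * θ)‖ ≤ 21 * Real.exp (-β) := by
  have hβ0 : 0 < β := by linarith
  set T := Icc ⌈η - β⌉ ⌊η + β⌋ with hT
  have hwpos : ∀ θ, 0 < windowHat β θ := fun θ =>
    mul_pos (Real.sqrt_pos.mpr hβ0) (Real.exp_pos _)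
  have hw0 : ∀ θ, (windowHat β θ : ℂ) ≠ 0 := fun θ => by exact_mod_cast (hwpos θ).ne'
  set S : ℤ → ℂ := fun t =>
    ∑ l ∈ Icc ⌈P * θ - β⌉ ⌊P * θ + β⌋, (window β (P * θ - l) : ℂ) * cis (l * (t / P)) with hS
  set E := 7 * √β * Real.exp (-Real.pi * β / 2) with hE
  set w := Real.exp (Real.pi * β / 16) / √β with hw
  have hsβ : 0 < √β := Real.sqrt_pos.mpr hβ0
  -- The length P keeps every t/P in [-1/4, 1/4], where aliases are small and deconvolution costs at
  -- most e^{πβ/16} / √β.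
  have htP : ∀ t ∈ T, |(t : ℝ) / P| ≤ 1 / 4 := by
    intro t ht
    rw [hT, mem_Icc, Int.ceil_le, Int.le_floor] at ht
    rw [abs_div, abs_of_pos hP, div_le_iff₀ hP]
    have : |(t : ℝ)| ≤ |η| + β := by
      rw [abs_le]
      constructor <;> linarith [ht.1, ht.2, neg_abs_le η, le_abs_self η]
    linarith
  have hSt : ∀ t ∈ T, ‖S t - windowHat β (t / P) * cis (t * θ)‖ ≤ E := by
    intro t ht
    have := norm_sum_window_mul_cis_sub_le hβ (P * θ) (htP t ht)
    rwa [show P * θ * (t / P) = t * θ by field_simp] at this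
  have h1 := norm_sum_window_mul_cis_sub_le hβ η hθ
  rw [← hT, ← hE] at h1
  have split : ((windowHat β θ)⁻¹ : ℂ) * ∑ t ∈ T, (window β (η - t) : ℂ) *
      (((windowHat β (t / P))⁻¹ : ℂ) * S t) - cis (η * θ)
      = ((windowHat β θ)⁻¹ : ℂ) * ((∑ t ∈ T, (window β (η - t) : ℂ) * cis (t * θ)
          - windowHat β θ * cis (η * θ)) +
        ∑ t ∈ T, (window β (η - t) : ℂ) * (((windowHat β (t / P))⁻¹ : ℂ) *
          (S t - windowHat β (t / P) * cis (t * θ)))) := by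
    have : ∀ t : ℤ, (window β (η - t) : ℂ) * (((windowHat β (t / P))⁻¹ : ℂ) *
          (S t - windowHat β (t / P) * cis (t * θ)))
        = (window β (η - t) : ℂ) * (((windowHat β (t / P))⁻¹ : ℂ) * S t)
          - (window β (η - t) : ℂ) * cis (t * θ) := by
      intro t
      rw [mul_sub, inv_mul_cancel_left₀ (hw0 _), mul_sub]
    rw [sum_congr rfl fun t _ => this t, sum_sub_distrib, mul_add, mul_sub, mul_sub,
      inv_mul_cancel_left₀ (hw0 θ)]
    ring
  have hE0 : 0 ≤ E := by positivity
  have hw0' : 0 ≤ w := by positivity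
  have h2 : ‖∑ t ∈ T, (window β (η - t) : ℂ) * (((windowHat β (t / P))⁻¹ : ℂ) *
      (S t - windowHat β (t / P) * cis (t * θ)))‖ ≤ 2 * √β * (w * E) := by
    calc _ ≤ ∑ t ∈ T, window β (η - t) * (w * E) := by
          refine (norm_sum_le _ _).trans (sum_le_sum fun t ht => ?_)
          rw [norm_mul, norm_mul, norm_inv, Complex.norm_real, Complex.norm_real,
            Real.norm_of_nonneg (window_pos _ _).le, Real.norm_of_nonneg (hwpos _).le]
          have := (window_pos β (η - t)).le
          have := inv_windowHat_le hβ0 (htP t ht)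
          have := hSt t ht
          gcongr
      _ ≤ _ := by
          rw [← sum_mul]
          have := sum_window_le hβ η T
          gcongr
  rw [split, norm_mul, norm_inv, Complex.norm_real, Real.norm_of_nonneg (hwpos _).le]
  -- The cut-off gains e^{-πβ/2} and the two deconvolutions lose e^{πβ/16} each; what remains is
  -- e^{-3πβ/8}, and 3π/8 > 1.
  calc _ ≤ w * (E + 2 * √β * (w * E)) := by
        have := inv_windowHat_le hβ0 hθ
        have h3 := (norm_add_le _ _).trans (add_le_add h1 h2)
        gcongr
    _ = 7 * (Real.exp (Real.pi * β / 16) * Real.exp (-Real.pi * β / 2)) *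
          (1 + 2 * Real.exp (Real.pi * β / 16)) := by rw [hw, hE]; field_simp
    _ ≤ 7 * (Real.exp (Real.pi * β / 16) * Real.exp (-Real.pi * β / 2)) *
          (3 * Real.exp (Real.pi * β / 16)) := by
        have : 1 ≤ Real.exp (Real.pi * β / 16) :=
          Real.one_le_exp (by have := Real.pi_pos; positivity)
        gcongr
        linarith
    _ = 21 * Real.exp (-(3 * Real.pi / 8) * β) := by
        rw [mul_mul_mul_comm, ← Real.exp_add, ← Real.exp_add]
        norm_num
        ring
    _ ≤ 21 * Real.exp (-β) := by
        gcongr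
        have := Real.pi_gt_three
        nlinarith

end

end DiskEval

namespace DiskEval

section

open Finset

/-! ### Accuracy of the nonequispaced fast Fourier transform -/

theorem sum_range_two_mul (f : ℕ → ℂ) (n : ℕ) :
    ∑ i ∈ range (2 * n), f i = ∑ i ∈ range n, f (2 * i) + ∑ i ∈ range n, f (2 * i + 1) := by
  induction n with
  | zero => simp
  | succ n ih =>
    rw [show 2 * (n + 1) = 2 * n + 1 + 1 by ring, sum_range_succ, sum_range_succ, ih,
      sum_range_succ, sum_range_succ]
    ring

theorem fft_val (n : ℕ) : ∀ (a : ℕ → ℂ) (l : ℕ), l < 2 ^ n →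
    (fft n a).val l = ∑ i ∈ range (2 ^ n), a i * cis ((i : ℝ) * l / 2 ^ n) := by
  induction n with
  | zero =>
    intro a l hl
    have : l = 0 := by simpa using hl
    subst this
    simp [fft, pure, cis]
  | succ n ih =>
    intro a l hl
    have hval : (fft (n + 1) a).val l = (fft n fun i => a (2 * i)).val (l % 2 ^ n) +
        cis ((l : ℝ) / 2 ^ (n + 1)) * (fft n fun i => a (2 * i + 1)).val (l % 2 ^ n) := by
      simp only [fft, bind, Flops.forEach, Flops.mul, Flops.add]
      rw [if_pos (mem_range.mpr hl)]
    have hmod : ∀ i : ℕ, cis ((i : ℝ) * ((l % 2 ^ n : ℕ) : ℝ) / 2 ^ n) = cis ((i : ℝ) * l / 2 ^ n) := by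
      intro i
      rw [← cis_add_int _ ((i * (l / 2 ^ n) : ℕ) : ℤ)]
      congr 1
      have h : ((l : ℕ) : ℝ) = ((l % 2 ^ n : ℕ) : ℝ) + 2 ^ n * ((l / 2 ^ n : ℕ) : ℝ) := by
        exact_mod_cast (Nat.mod_add_div l (2 ^ n)).symm
      rw [h, Int.cast_natCast, Nat.cast_mul]
      field_simp
    have hlt : l % 2 ^ n < 2 ^ n := Nat.mod_lt _ (by positivity)
    rw [hval, ih _ _ hlt, ih _ _ hlt, (pow_succ' 2 n : (2 : ℕ) ^ (n + 1) = _),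
      sum_range_two_mul, mul_sum]
    simp only [hmod]
    congr 1
    · refine sum_congr rfl fun i _ => ?_
      congr 2
      push_cast
      field_simp
      ring
    · refine sum_congr rfl fun i _ => ?_
      rw [mul_left_comm, ← cis_add]
      congr 2
      push_cast
      field_simp
      ring

/-- Reducing either the frequency or the grid index modulo P changes the phase by an integer. -/
theorem cis_signedIndex (P a : ℕ) (hP : 0 < P) (l : ℤ) :
    cis ((a : ℝ) * ((l % (P : ℤ)).toNat : ℝ) / P) = cis (l * ((signedIndex P a : ℝ) / P)) := by
  have hP' : (P : ℝ) ≠ 0 := by positivity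
  have h1 : (((l % (P : ℤ)).toNat : ℕ) : ℝ) = (l : ℝ) - P * ((l / (P : ℤ) : ℤ) : ℝ) := by
    have e1 : (((l % (P : ℤ)).toNat : ℕ) : ℤ) = l % P :=
      Int.toNat_of_nonneg (Int.emod_nonneg _ (by exact_mod_cast hP.ne'))
    have e2 : (((l % (P : ℤ)).toNat : ℕ) : ℤ) = l - P * (l / P) := by
      rw [e1, Int.emod_def]
    exact_mod_cast congrArg (Int.cast : ℤ → ℝ) e2
  obtain ⟨e, he⟩ : ∃ e : ℤ, (a : ℝ) = (signedIndex P a : ℝ) + P * e := by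
    unfold signedIndex
    split_ifs
    · exact ⟨0, by simp⟩
    · exact ⟨1, by push_cast; ring⟩
  rw [← cis_add_int (l * ((signedIndex P a : ℝ) / P)) (l * e - a * (l / P)), h1]
  congr 1
  push_cast
  field_simp
  rw [he]
  ring

/-- The window around η lies in [-P/4, P/4], so it does not wrap around and each of its integers has
exactly one array position. -/
theorem sum_signedIndex {P : ℕ} {η β : ℝ} (hβ : 0 < β) (h : 4 * (|η| + β) ≤ P) (f : ℤ → ℂ) :
    ∑ a ∈ range P, (if |η - signedIndex P a| ≤ β then f (signedIndex P a) else 0)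
      = ∑ t ∈ Icc ⌈η - β⌉ ⌊η + β⌋, f t := by
  have hP : (0 : ℝ) < P := by have := abs_nonneg η; linarith
  have hP' : 0 < P := by exact_mod_cast hP
  have hT : ∀ t ∈ Icc ⌈η - β⌉ ⌊η + β⌋, η - β ≤ t ∧ (t : ℝ) ≤ η + β ∧ 4 * |t| ≤ (P : ℤ) := by
    intro t ht
    rw [mem_Icc, Int.ceil_le, Int.le_floor] at ht
    refine ⟨ht.1, ht.2, ?_⟩
    have : |(t : ℝ)| ≤ |η| + β := by
      rw [abs_le]
      constructor <;> linarith [ht.1, ht.2, neg_abs_le η, le_abs_self η]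
    have h2 : 4 * |(t : ℝ)| ≤ P := by linarith
    exact_mod_cast h2
  have hinv : ∀ t ∈ Icc ⌈η - β⌉ ⌊η + β⌋, signedIndex P (t % (P : ℤ)).toNat = t := by
    intro t ht
    have h4 := (hT t ht).2.2
    have habs := abs_le.mp (le_refl |t|)
    unfold signedIndex
    rcases le_or_gt 0 t with h0 | h0
    · rw [Int.emod_eq_of_lt h0 (by omega)]
      split_ifs <;> omega
    · have : t % (P : ℤ) = t + P := by
        rw [← Int.add_emod_right, Int.emod_eq_of_lt] <;> omega
      rw [this]
      split_ifs <;> omega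
  rw [← sum_filter]
  refine sum_nbij' (signedIndex P) (fun t => (t % (P : ℤ)).toNat) ?_ ?_ ?_ hinv fun _ _ => rfl
  · intro a ha
    have := abs_le.mp (mem_filter.mp ha).2
    exact mem_Icc.mpr ⟨Int.ceil_le.mpr (by linarith), Int.le_floor.mpr (by linarith)⟩
  · intro t ht
    have h0 := Int.emod_nonneg t (by exact_mod_cast hP'.ne' : (P : ℤ) ≠ 0)
    have h1 := Int.emod_lt_of_pos t (by exact_mod_cast hP' : 0 < (P : ℤ))
    refine mem_filter.mpr ⟨mem_range.mpr (by omega), ?_⟩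
    rw [hinv t ht, abs_le]
    constructor <;> linarith [(hT t ht).1, (hT t ht).2.1]
  · intro a ha
    have ha' := mem_range.mp (mem_filter.mp ha).1
    unfold signedIndex
    split_ifs
    · rw [Int.emod_eq_of_lt] <;> omega
    · rw [Int.sub_emod_right, Int.emod_eq_of_lt] <;> omega

theorem directFourier_val (N : ℕ) (x ξ : Fin N → ℝ) (c : Fin N → ℂ) (j : Fin N) :
    (directFourier N x ξ c).val j = ∑ k, cis (ξ k * x j) * c k := by
  simp [directFourier, Flops.forEach, Flops.lincomb, Flops.sum, Flops.mul]

theorem nnfft_val_of_lt {N : ℕ} {δ : ℝ} (h : ¬ N ≤ cutoff δ) (x ξ : Fin N → ℝ) (c : Fin N → ℂ)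
    (j : Fin N) {β P : ℕ} (hβ : β = cutoff δ) (hP : P = 2 ^ Nat.clog 2 (4 * (N + β))) {θ : ℝ}
    (hθ : θ = (x j - 1 / 2) / 2) :
    (nnfft N δ x ξ c).val j = cis (θ * N) / (windowHat β θ : ℂ) *
      ∑ l ∈ Icc ⌈(P : ℝ) * θ - β⌉ ⌊(P : ℝ) * θ + β⌋, (window β (P * θ - l) : ℂ) *
        ∑ a ∈ range P, (((1 / windowHat β ((signedIndex P a : ℝ) / P) : ℝ) : ℂ) *
          ∑ k with |2 * ξ k - (N + signedIndex P a)| ≤ (β : ℝ),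
            (window β (2 * ξ k - (N + signedIndex P a)) : ℂ) * (cis (ξ k / 2) * c k)) *
          cis (l * ((signedIndex P a : ℝ) / P)) := by
  have hP0 : 0 < P := by rw [hP]; positivity
  have h' : ¬ N ≤ β := hβ ▸ h
  simp only [nnfft, ← hβ, ← hP, if_neg h', bind, Flops.forEach, Flops.mul, Flops.lincomb, Flops.sum,
    mem_univ, if_true]
  rw [← hθ]
  congr 1
  refine sum_congr rfl fun l _ => ?_
  have hlt : (l % (P : ℤ)).toNat < P := by
    have h0 := Int.emod_nonneg l (by exact_mod_cast hP0.ne' : (P : ℤ) ≠ 0)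
    have h1 := Int.emod_lt_of_pos l (by exact_mod_cast hP0 : 0 < (P : ℤ))
    omega
  congr 1
  rw [fft_val _ _ _ (hP ▸ hlt), ← hP]
  refine sum_congr rfl fun a ha => ?_
  rw [if_pos ha]
  congr 1
  rw [← cis_signedIndex P a hP0 l, hP]
  push_cast
  rfl

/-- The summand 10 in the cut-off absorbs the factor 21 of `norm_double_window_sub_le`. -/
theorem exp_neg_cutoff_le {δ : ℝ} (hδ : 0 < δ) : 21 * Real.exp (-(cutoff δ : ℝ)) ≤ δ := by
  have h1 : Real.log (1 / δ) + 10 ≤ (cutoff δ : ℝ) := by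
    unfold cutoff
    push_cast
    linarith [Nat.le_ceil (Real.log (1 / δ))]
  rw [one_div, Real.log_inv] at h1
  have h2 : Real.exp (-(cutoff δ : ℝ)) ≤ δ * Real.exp (-10) := by
    calc Real.exp (-(cutoff δ : ℝ)) ≤ Real.exp (Real.log δ + -10) :=
          Real.exp_le_exp.mpr (by linarith)
      _ = _ := by rw [Real.exp_add, Real.exp_log hδ]
  have h3 : (21 : ℝ) ≤ Real.exp 10 := by
    have h4 : Real.exp 10 = Real.exp 1 ^ 10 := by rw [← Real.exp_nat_mul]; norm_num
    rw [h4]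
    calc (21 : ℝ) ≤ 2 ^ 10 := by norm_num
      _ ≤ _ := by gcongr; linarith [Real.exp_one_gt_d9]
  have h5 : 21 * Real.exp (-10) ≤ 1 := by
    rw [Real.exp_neg, ← div_eq_mul_inv, div_le_one (Real.exp_pos _)]
    exact h3
  nlinarith

/-- The identity ξx = θN + (2ξ - N)θ + ξ/2 with θ = (x - 1/2)/2 centers both variables: |θ| ≤ 1/4
and |2ξ - N| ≤ N. The outer phases are applied exactly; only the middle one is approximated. -/
theorem nnfft_isAccurate {N : ℕ} {δ : ℝ} (hδ : 0 < δ) (x ξ : Fin N → ℝ)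
    (hx : ∀ j, x j ∈ Set.Ico (0 : ℝ) 1) (hξ : ∀ k, ξ k ∈ Set.Icc (0 : ℝ) N) :
    FourierMethod.IsAccurate nnfft N δ x ξ := by
  intro c j
  by_cases hN : N ≤ cutoff δ
  · have : nnfft N δ x ξ c = directFourier N x ξ c := by simp only [nnfft, if_pos hN]
    rw [this, directFourier_val, sub_self, norm_zero]
    positivity
  obtain ⟨β, hβ⟩ : ∃ β, β = cutoff δ := ⟨_, rfl⟩
  obtain ⟨P, hP⟩ : ∃ P, P = 2 ^ Nat.clog 2 (4 * (N + β)) := ⟨_, rfl⟩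
  obtain ⟨θ, hθ⟩ : ∃ θ, θ = (x j - 1 / 2) / 2 := ⟨_, rfl⟩
  rw [nnfft_val_of_lt hN x ξ c j hβ hP hθ]
  have hβ10 : (10 : ℝ) ≤ β := by
    have : 10 ≤ β := by rw [hβ]; unfold cutoff; omega
    exact_mod_cast this
  have hPle : 4 * ((N : ℝ) + β) ≤ P := by
    have := Nat.le_pow_clog (b := 2) (by norm_num) (4 * (N + β))
    rw [← hP] at this
    exact_mod_cast this
  have hθ4 : |θ| ≤ 1 / 4 := by
    rw [hθ, abs_le]
    have := hx j
    constructor <;> linarith [this.1, this.2]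
  have hη : ∀ k, 4 * (|2 * ξ k - N| + β) ≤ (P : ℝ) := by
    intro k
    have h1 : |2 * ξ k - N| ≤ N := by
      rw [abs_le]; constructor <;> linarith [(hξ k).1, (hξ k).2]
    linarith
  have hP0 : (0 : ℝ) < P := by have : (0 : ℝ) ≤ N := by positivity
                               linarith
  set D : ℤ → ℂ := fun t => ((windowHat β (t / P))⁻¹ : ℂ) *
    ∑ l ∈ Icc ⌈(P : ℝ) * θ - β⌉ ⌊(P : ℝ) * θ + β⌋,
      (window β (P * θ - l) : ℂ) * cis (l * (t / P)) with hD
  -- Interchanging the sums shows each coefficient multiplied by the double window sum of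
  -- `norm_double_window_sub_le`.
  have hout : cis (θ * N) / (windowHat β θ : ℂ) *
      ∑ l ∈ Icc ⌈(P : ℝ) * θ - β⌉ ⌊(P : ℝ) * θ + β⌋, (window β (P * θ - l) : ℂ) *
        ∑ a ∈ range P, (((1 / windowHat β ((signedIndex P a : ℝ) / P) : ℝ) : ℂ) *
          ∑ k with |2 * ξ k - (N + signedIndex P a)| ≤ (β : ℝ),
            (window β (2 * ξ k - (N + signedIndex P a)) : ℂ) * (cis (ξ k / 2) * c k)) *
          cis (l * ((signedIndex P a : ℝ) / P))
      = ∑ k, cis (θ * N) * (((windowHat β θ)⁻¹ : ℂ) *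
          ∑ t ∈ Icc ⌈2 * ξ k - N - β⌉ ⌊2 * ξ k - N + β⌋,
            (window β (2 * ξ k - N - t) : ℂ) * D t) * (cis (ξ k / 2) * c k) := by
    simp only [mul_sum (s := range P)]
    rw [sum_comm]
    have h1 : ∀ a : ℕ, ∑ l ∈ Icc ⌈(P : ℝ) * θ - β⌉ ⌊(P : ℝ) * θ + β⌋, (window β (P * θ - l) : ℂ) *
        ((((1 / windowHat β ((signedIndex P a : ℝ) / P) : ℝ) : ℂ) *
          ∑ k with |2 * ξ k - (N + signedIndex P a)| ≤ (β : ℝ),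
            (window β (2 * ξ k - (N + signedIndex P a)) : ℂ) * (cis (ξ k / 2) * c k)) *
          cis (l * ((signedIndex P a : ℝ) / P)))
        = ∑ k, (if |2 * ξ k - N - signedIndex P a| ≤ (β : ℝ) then
            (window β (2 * ξ k - N - signedIndex P a) : ℂ) * D (signedIndex P a) else 0) *
            (cis (ξ k / 2) * c k) := by
      intro a
      have h2 : ∀ (w v : ℂ) (d : ℤ → ℂ) (e : ℤ → ℂ) (T : Finset ℤ),
          ∑ l ∈ T, d l * ((w * v) * e l) = v * (w * ∑ l ∈ T, d l * e l) := by
        intro w v d e T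
        simp only [mul_sum]
        exact sum_congr rfl fun l _ => by ring
      rw [h2, sum_filter, sum_mul]
      refine sum_congr rfl fun k _ => ?_
      rw [sub_sub]
      split_ifs
      · simp only [hD]
        push_cast
        ring
      · simp
    rw [sum_congr rfl fun a _ => h1 a, sum_comm, mul_sum]
    refine sum_congr rfl fun k _ => ?_
    rw [← sum_mul, sum_signedIndex (by linarith) (hη k)
      (fun t => (window β (2 * ξ k - N - t) : ℂ) * D t)]
    ring
  rw [hout, ← sum_sub_distrib, mul_sum]
  refine (norm_sum_le _ _).trans (sum_le_sum fun k _ => ?_)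
  have hphase : cis (ξ k * x j) = cis (θ * N) * cis ((2 * ξ k - N) * θ) * cis (ξ k / 2) := by
    rw [← cis_add, ← cis_add, hθ]
    congr 1; ring
  have key := norm_double_window_sub_le hβ10 hP0 (hη k) hθ4
  have : cis (θ * N) * (((windowHat β θ)⁻¹ : ℂ) *
      ∑ t ∈ Icc ⌈2 * ξ k - N - β⌉ ⌊2 * ξ k - N + β⌋,
        (window β (2 * ξ k - N - t) : ℂ) * D t) * (cis (ξ k / 2) * c k) - cis (ξ k * x j) * c k
      = cis (θ * N) * (((windowHat β θ)⁻¹ : ℂ) *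
      ∑ t ∈ Icc ⌈2 * ξ k - N - β⌉ ⌊2 * ξ k - N + β⌋,
        (window β (2 * ξ k - N - t) : ℂ) * D t - cis ((2 * ξ k - N) * θ)) *
        (cis (ξ k / 2) * c k) := by
    rw [hphase]; ring
  rw [this, norm_mul, norm_mul, norm_mul, norm_cis, norm_cis, one_mul, one_mul]
  refine mul_le_mul_of_nonneg_right ?_ (norm_nonneg _)
  refine key.trans ?_
  rw [hβ]
  exact exp_neg_cutoff_le hδ

end

end DiskEval

namespace DiskEval

section

open Finset

/-! ### Accuracy of the butterfly sparse Fourier transform -/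

/-- Rotating by the argument α of the error makes it real and nonnegative, so the real estimate
applies to cos(ct - α), whose derivatives are quarter-period phase shifts. This avoids a loss from
treating real and imaginary parts separately. -/
theorem norm_cis_sub_interpolate_le {p : ℕ} (hp : 1 ≤ p) {a b x : ℝ} (h : a < b)
    (hx : x ∈ Set.Icc a b) (ω : ℝ) :
    ‖cis (ω * x) - ∑ s : Fin p, (lagrange p a b s x : ℂ) * cis (ω * chebNode p a b s)‖
      ≤ 2 * (2 * Real.pi * |ω| * ((b - a) / 4)) ^ p / p.factorial := by
  set E := cis (ω * x) - ∑ s : Fin p, (lagrange p a b s x : ℂ) * cis (ω * chebNode p a b s) with hE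
  set α := Complex.arg E
  set c := 2 * Real.pi * ω with hc
  have hf : ∀ (n : ℕ) (t : ℝ), HasDerivAt (fun t => c ^ n * Real.cos (c * t - α + n * (Real.pi / 2)))
      (c ^ (n + 1) * Real.cos (c * t - α + (n + 1 : ℕ) * (Real.pi / 2))) t := by
    intro n t
    have h1 : HasDerivAt (fun t : ℝ => c * t - α + n * (Real.pi / 2)) (c * 1) t :=
      (((hasDerivAt_id t).const_mul c).sub_const α).add_const _
    refine (h1.cos.const_mul (c ^ n)).congr_deriv ?_
    rw [show c * t - α + ((n + 1 : ℕ) : ℝ) * (Real.pi / 2)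
      = c * t - α + n * (Real.pi / 2) + Real.pi / 2 by push_cast; ring, Real.cos_add_pi_div_two]
    ring
  have hre : ∀ t : ℝ, (cis (ω * t) * Complex.exp (-α * Complex.I)).re = Real.cos (c * t - α) := by
    intro t
    rw [cis, ← Complex.exp_add, ← Complex.exp_ofReal_mul_I_re]
    congr 2
    rw [hc]; push_cast; ring
  have hEre : ‖E‖ = Real.cos (c * x - α)
      - ∑ s : Fin p, lagrange p a b s x * Real.cos (c * chebNode p a b s - α) := by
    have h1 : E * Complex.exp (-α * Complex.I) = ‖E‖ := by
      conv_lhs => rw [← Complex.norm_mul_exp_arg_mul_I E]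
      rw [mul_assoc, ← Complex.exp_add, ← add_mul]
      simp [α]
    have h2 := congrArg Complex.re h1
    rw [Complex.ofReal_re, hE, sub_mul, sum_mul, Complex.sub_re, hre, Complex.re_sum] at h2
    rw [← h2]
    congr 1
    refine sum_congr rfl fun s _ => ?_
    rw [mul_assoc, Complex.re_ofReal_mul, hre]
  have key := abs_sub_interpolate_le
    (f := fun n t => c ^ n * Real.cos (c * t - α + n * (Real.pi / 2))) hf hp h
    (B := |c| ^ p) (by
      intro t _
      rw [abs_mul, abs_pow]
      exact mul_le_of_le_one_right (by positivity) (Real.abs_cos_le_one _)) hx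
  simp only [pow_zero, one_mul, Nat.cast_zero, zero_mul, add_zero] at key
  rw [← hEre, abs_of_nonneg (norm_nonneg _)] at key
  refine key.trans (le_of_eq ?_)
  rw [hc, abs_mul, abs_of_pos (by have := Real.pi_pos; positivity : 0 < 2 * Real.pi), mul_pow _ ((b - a) / 4)]
  ring

/-- The interpolation error of the butterfly scheme in one step. -/
noncomputable def boxError (p : ℕ) : ℝ := 2 * (Real.pi / 4) ^ p / p.factorial

theorem boxError_nonneg (p : ℕ) : 0 ≤ boxError p := by
  have := Real.pi_pos
  unfold boxError; positivity

theorem norm_boxBasis (p l i b : ℕ) (s : Fin p) (t : ℝ) :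
    ‖boxBasis p l i b s t‖ = |lagrange p ((i : ℝ) / 2 ^ l) (((i : ℝ) + 1) / 2 ^ l) s t| := by
  rw [boxBasis, norm_mul, norm_cis, one_mul, Complex.norm_real, Real.norm_eq_abs]

theorem box_lt (l i : ℕ) : (i : ℝ) / 2 ^ l < ((i : ℝ) + 1) / 2 ^ l := by
  gcongr; linarith

/-- Demodulation by the box midpoint leaves frequencies of modulus at most 2^l / 2 on a space box of
length 2^{-l}, so 2π · (2^l / 2) · (2^{-l} / 4) = π/4 on every level. -/
theorem norm_cis_sub_boxBasis_le {p : ℕ} (hp : 1 ≤ p) (l i b : ℕ) {x ξ : ℝ}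
    (hx : x ∈ Set.Icc ((i : ℝ) / 2 ^ l) (((i : ℝ) + 1) / 2 ^ l))
    (hξ : ξ ∈ Set.Icc ((b : ℝ) * 2 ^ l) (((b : ℝ) + 1) * 2 ^ l)) :
    ‖cis (ξ * x) - ∑ s, boxBasis p l i b s x * cis (ξ * boxNode p l i s)‖ ≤ boxError p := by
  set μ := ((b : ℝ) + 1 / 2) * 2 ^ l with hμ
  have hω : |ξ - μ| ≤ 2 ^ l / 2 := by
    rw [abs_le]; constructor <;> linarith [hξ.1, hξ.2]
  have h := norm_cis_sub_interpolate_le hp (box_lt l i) hx (ξ - μ)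
  have e : cis (ξ * x) - ∑ s, boxBasis p l i b s x * cis (ξ * boxNode p l i s)
      = cis (μ * x) * (cis ((ξ - μ) * x) - ∑ s : Fin p,
        (lagrange p ((i : ℝ) / 2 ^ l) (((i : ℝ) + 1) / 2 ^ l) s x : ℂ) *
          cis ((ξ - μ) * chebNode p ((i : ℝ) / 2 ^ l) (((i : ℝ) + 1) / 2 ^ l) s)) := by
    rw [mul_sub, ← cis_add, mul_sum]
    congr 1
    · congr 1; ring
    · refine sum_congr rfl fun s _ => ?_
      rw [boxBasis, mul_left_comm, ← cis_add, mul_right_comm, ← cis_add, mul_comm (cis _), boxNode]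
      congr 2
      rw [hμ]; ring
  rw [e, norm_mul, norm_cis, one_mul]
  refine h.trans ?_
  unfold boxError
  have hpi := Real.pi_pos
  have hlen : (((i : ℝ) + 1) / 2 ^ l - (i : ℝ) / 2 ^ l) / 4 = 1 / (4 * 2 ^ l) := by
    field_simp; ring
  rw [hlen]
  gcongr
  calc 2 * Real.pi * |ξ - μ| * (1 / (4 * 2 ^ l)) ≤ 2 * Real.pi * (2 ^ l / 2) * (1 / (4 * 2 ^ l)) := by
        gcongr
    _ = Real.pi / 4 := by field_simp

theorem sum_norm_boxBasis_le {p : ℕ} (hp : 1 ≤ p) (l i b : ℕ) {x : ℝ}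
    (hx : x ∈ Set.Icc ((i : ℝ) / 2 ^ l) (((i : ℝ) + 1) / 2 ^ l)) :
    ∑ s, ‖boxBasis p l i b s x‖ ≤ p := by
  simp only [norm_boxBasis]
  refine (sum_abs_lagrange_le hp (box_lt l i) hx).trans ?_
  rw [Real.sqrt_le_left (by positivity)]
  nlinarith [sq_nonneg ((p : ℝ) - 1)]

/-- One step of the error recursion: old errors grow by the Lebesgue constant, bounded crudely by p,
and one fresh interpolation error is added. -/
theorem norm_boxInterpolate_sub_le {p : ℕ} (hp : 1 ≤ p) (l i b : ℕ) {ι : Type} (K : Finset ι)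
    (ξ : ι → ℝ) (c : ι → ℂ) {x : ℝ}
    (hx : x ∈ Set.Icc ((i : ℝ) / 2 ^ l) (((i : ℝ) + 1) / 2 ^ l))
    (hξ : ∀ k ∈ K, ξ k ∈ Set.Icc ((b : ℝ) * 2 ^ l) (((b : ℝ) + 1) * 2 ^ l))
    (v : Fin p → ℂ) {τ : ℝ} (hτ : 0 ≤ τ)
    (hv : ∀ s, ‖v s - ∑ k ∈ K, cis (ξ k * boxNode p l i s) * c k‖ ≤ τ * ∑ k ∈ K, ‖c k‖) :
    ‖∑ s, boxBasis p l i b s x * v s - ∑ k ∈ K, cis (ξ k * x) * c k‖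
      ≤ (p * τ + boxError p) * ∑ k ∈ K, ‖c k‖ := by
  have e : ∑ s, boxBasis p l i b s x * v s - ∑ k ∈ K, cis (ξ k * x) * c k
      = ∑ s, boxBasis p l i b s x * (v s - ∑ k ∈ K, cis (ξ k * boxNode p l i s) * c k)
        - ∑ k ∈ K, (cis (ξ k * x) - ∑ s, boxBasis p l i b s x * cis (ξ k * boxNode p l i s)) * c k := by
    simp only [mul_sub, sub_mul, sum_sub_distrib, mul_sum, sum_mul]
    rw [sum_comm (s := K)]
    simp only [mul_assoc]
    ring
  rw [e, add_mul]
  refine (norm_sub_le _ _).trans (add_le_add ?_ ?_)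
  · have hW : 0 ≤ τ * ∑ k ∈ K, ‖c k‖ := mul_nonneg hτ (sum_nonneg fun _ _ => norm_nonneg _)
    calc _ ≤ ∑ s, ‖boxBasis p l i b s x‖ * (τ * ∑ k ∈ K, ‖c k‖) := by
          refine (norm_sum_le _ _).trans (sum_le_sum fun s _ => ?_)
          rw [norm_mul]
          exact mul_le_mul_of_nonneg_left (hv s) (norm_nonneg _)
      _ ≤ p * (τ * ∑ k ∈ K, ‖c k‖) := by
          rw [← sum_mul]
          exact mul_le_mul_of_nonneg_right (sum_norm_boxBasis_le hp l i b hx) hW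
      _ = _ := by ring
  · rw [mul_sum]
    refine (norm_sum_le _ _).trans (sum_le_sum fun k hk => ?_)
    rw [norm_mul]
    exact mul_le_mul_of_nonneg_right (norm_cis_sub_boxBasis_le hp l i b hx (hξ k hk)) (norm_nonneg _)

theorem boxNode_mem_parent {p : ℕ} (l i : ℕ) (r : Fin p) :
    boxNode p (l + 1) i r ∈ Set.Icc (((i / 2 : ℕ) : ℝ) / 2 ^ l) ((((i / 2 : ℕ) : ℝ) + 1) / 2 ^ l) := by
  have h := chebNode_mem (box_lt (l + 1) i).le r
  have h1 : (2 * ((i / 2 : ℕ) : ℝ)) ≤ i := by exact_mod_cast (by omega : 2 * (i / 2) ≤ i)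
  have h2 : (i : ℝ) + 1 ≤ 2 * (((i / 2 : ℕ) : ℝ) + 1) := by
    exact_mod_cast (by omega : i + 1 ≤ 2 * (i / 2 + 1))
  refine ⟨le_trans ?_ h.1, h.2.trans ?_⟩
  · rw [pow_succ, div_le_div_iff₀ (by positivity) (by positivity)]
    nlinarith [(by positivity : (0 : ℝ) < 2 ^ l)]
  · rw [pow_succ, div_le_div_iff₀ (by positivity) (by positivity)]
    nlinarith [(by positivity : (0 : ℝ) < 2 ^ l)]

/-- The indices of the frequencies in the box `(b * 2 ^ l, (b + 1) * 2 ^ l]`. -/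
noncomputable def freqBox {N : ℕ} (ξ : Fin N → ℝ) (l b : ℕ) : Finset (Fin N) :=
  univ.filter fun k => (b : ℝ) * 2 ^ l < ξ k ∧ ξ k ≤ ((b : ℝ) + 1) * 2 ^ l

theorem mem_Icc_of_mem_freqBox {N : ℕ} {ξ : Fin N → ℝ} {l b : ℕ} {k : Fin N}
    (hk : k ∈ freqBox ξ l b) : ξ k ∈ Set.Icc ((b : ℝ) * 2 ^ l) (((b : ℝ) + 1) * 2 ^ l) :=
  let h := (mem_filter.mp hk).2
  ⟨h.1.le, h.2⟩

theorem sum_freqBox_succ {N : ℕ} (ξ : Fin N → ℝ) (l b : ℕ) {M : Type} [AddCommMonoid M]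
    (f : Fin N → M) : ∑ k ∈ freqBox ξ (l + 1) b, f k
      = ∑ k ∈ freqBox ξ l (2 * b), f k + ∑ k ∈ freqBox ξ l (2 * b + 1), f k := by
  rw [← sum_union]
  · congr 1
    ext k
    simp only [freqBox, mem_union, mem_filter, mem_univ, true_and]
    push_cast
    have e1 : (b : ℝ) * 2 ^ (l + 1) = 2 * b * 2 ^ l := by ring
    have e2 : ((b : ℝ) + 1) * 2 ^ (l + 1) = (2 * b + 1 + 1) * 2 ^ l := by ring
    have e3 : (2 * (b : ℝ)) * 2 ^ l < (2 * b + 1) * 2 ^ l := by gcongr; linarith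
    have e4 : (2 * (b : ℝ) + 1) * 2 ^ l < (2 * b + 1 + 1) * 2 ^ l := by gcongr; linarith
    rw [e1, e2]
    constructor
    · rintro ⟨h1, h2⟩
      rcases le_or_gt (ξ k) ((2 * (b : ℝ) + 1) * 2 ^ l) with h | h
      · exact Or.inl ⟨h1, h⟩
      · exact Or.inr ⟨h, h2⟩
    · rintro (⟨h1, h2⟩ | ⟨h1, h2⟩)
      · exact ⟨h1, h2.trans e4.le⟩
      · exact ⟨e3.trans h1, h2⟩
  · rw [disjoint_left]
    intro k h1 h2
    have h1' := (mem_filter.mp h1).2.2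
    have h2' := (mem_filter.mp h2).2.1
    push_cast at h1' h2'
    linarith

/-- Level 0 is exact, and e_{l+1} ≤ p e_l + `boxError p` is solved by `boxError p` · l · p^l. The
frequency boxes of the two children are disjoint, so their coefficient norms add up. -/
theorem butterfly_error {N L p : ℕ} (hp : 1 ≤ p) (ξ : Fin N → ℝ) (c : Fin N → ℂ) (l : ℕ) :
    l ≤ L → ∀ i < 2 ^ l, ∀ b < 2 ^ (L - l), ∀ r : Fin p,
      ‖(butterfly N L p ξ c l).val i b r
          - ∑ k ∈ freqBox ξ l b, cis (ξ k * boxNode p l i r) * c k‖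
        ≤ boxError p * l * (p : ℝ) ^ l * ∑ k ∈ freqBox ξ l b, ‖c k‖ := by
  have hp' : (1 : ℝ) ≤ p := by exact_mod_cast hp
  induction l with
  | zero =>
    intro _ i hi b hb r
    have hi0 : i = 0 := by simpa using hi
    subst hi0
    simp only [butterfly, Flops.forEach, Flops.lincomb, Flops.sum, Flops.mul, freqBox]
    rw [if_pos (by simp), if_pos (mem_range.mpr (by simpa using hb)), if_pos (mem_univ r)]
    simp
  | succ l ih =>
    intro hl i hi b hb r
    have hL : 2 ^ (L - l) = 2 * 2 ^ (L - (l + 1)) := by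
      rw [← pow_succ', show L - (l + 1) + 1 = L - l by omega]
    have hi2 : i / 2 < 2 ^ l := by rw [pow_succ] at hi; omega
    have e0 := ih (by omega) (i / 2) hi2 (2 * b) (by omega)
    have e1 := ih (by omega) (i / 2) hi2 (2 * b + 1) (by omega)
    have hval : (butterfly N L p ξ c (l + 1)).val i b r =
        ∑ s, boxBasis p l (i / 2) (2 * b) s (boxNode p (l + 1) i r) *
          (butterfly N L p ξ c l).val (i / 2) (2 * b) s +
        ∑ s, boxBasis p l (i / 2) (2 * b + 1) s (boxNode p (l + 1) i r) *
          (butterfly N L p ξ c l).val (i / 2) (2 * b + 1) s := by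
      simp only [butterfly, bind, Flops.forEach, Flops.lincomb, Flops.sum, Flops.mul, Flops.add]
      rw [if_pos (mem_range.mpr hi), if_pos (mem_range.mpr hb), if_pos (mem_univ r)]
    have hκ := boxError_nonneg p
    have hτ : 0 ≤ boxError p * l * (p : ℝ) ^ l := by positivity
    have hx := boxNode_mem_parent (p := p) l i r
    have f0 := norm_boxInterpolate_sub_le hp l (i / 2) (2 * b) (freqBox ξ l (2 * b)) ξ c hx
      (fun k hk => mem_Icc_of_mem_freqBox hk) _ hτ e0
    have f1 := norm_boxInterpolate_sub_le hp l (i / 2) (2 * b + 1) (freqBox ξ l (2 * b + 1)) ξ c hx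
      (fun k hk => mem_Icc_of_mem_freqBox hk) _ hτ e1
    rw [hval, sum_freqBox_succ, sum_freqBox_succ, add_sub_add_comm, mul_add]
    have hstep : (p : ℝ) * (boxError p * l * (p : ℝ) ^ l) + boxError p
        ≤ boxError p * (l + 1 : ℕ) * (p : ℝ) ^ (l + 1) := by
      have h1 : (1 : ℝ) ≤ (p : ℝ) ^ (l + 1) := one_le_pow₀ hp'
      push_cast
      rw [pow_succ] at h1 ⊢
      nlinarith
    refine (norm_add_le _ _).trans (add_le_add (f0.trans ?_) (f1.trans ?_))
    · exact mul_le_mul_of_nonneg_right hstep (sum_nonneg fun _ _ => norm_nonneg _)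
    · exact mul_le_mul_of_nonneg_right hstep (sum_nonneg fun _ _ => norm_nonneg _)

theorem pow_div_factorial_le {p : ℕ} (hp : 1 ≤ p) : (p / Real.exp 1) ^ p ≤ (p.factorial : ℝ) := by
  have h := Stirling.le_factorial_stirling p
  have hp' : (1 : ℝ) ≤ p := by exact_mod_cast hp
  have h1 : 1 ≤ √(2 * Real.pi * p) := by
    rw [Real.one_le_sqrt]
    nlinarith [Real.pi_gt_three]
  exact (le_mul_of_one_le_left (by positivity) h1).trans h

/-- Write p = 2n with n = L + Q + 10. Stirling and (πe/4)² < 5 give an error 2 (5/p²)^n; half of the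
powers of p pay for p^{L+1}, and p ≥ 20 turns the rest into 4^{-n}. This pays for L + 1 ≤ 4^L, for
e^{-Q} ≤ δ and for the factor 2. -/
theorem expansionDegree_error_le {N : ℕ} {δ : ℝ} (hδ : 0 < δ) :
    boxError (expansionDegree N δ) * (Nat.clog 2 N + 1 : ℕ) *
      (expansionDegree N δ : ℝ) ^ (Nat.clog 2 N + 1) ≤ δ := by
  set L := Nat.clog 2 N
  set Q := ⌈Real.log (1 / δ)⌉₊ with hQ
  obtain ⟨n, hn⟩ : ∃ n, n = L + Q + 10 := ⟨_, rfl⟩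
  have hp : expansionDegree N δ = 2 * n := by unfold expansionDegree; omega
  rw [hp]
  set p : ℝ := ((2 * n : ℕ) : ℝ) with hpdef
  have hp20 : (20 : ℝ) ≤ p := by rw [hpdef]; exact_mod_cast (by omega : 20 ≤ 2 * n)
  have hpi := Real.pi_pos
  have h1 : boxError (2 * n) ≤ 2 * (5 / p ^ 2) ^ n := by
    have hf := pow_div_factorial_le (p := 2 * n) (by omega)
    have he : 0 < Real.exp 1 := Real.exp_pos 1
    have hpe : 0 < (p / Real.exp 1) ^ (2 * n) := by positivity
    calc boxError (2 * n) ≤ 2 * (Real.pi / 4) ^ (2 * n) / (p / Real.exp 1) ^ (2 * n) := by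
          unfold boxError; gcongr
      _ = 2 * ((Real.pi / 4 * Real.exp 1) ^ 2 / p ^ 2) ^ n := by
          rw [mul_div_assoc, ← div_pow, pow_mul, ← div_pow]
          congr 3
          field_simp
      _ ≤ _ := by
          gcongr
          have a1 : Real.pi < 3.15 := Real.pi_lt_d2
          have a2 : Real.exp 1 < 2.72 := Real.exp_one_lt_d9.trans (by norm_num)
          calc (Real.pi / 4 * Real.exp 1) ^ 2 ≤ (3.15 / 4 * 2.72) ^ 2 := by gcongr
            _ ≤ 5 := by norm_num
  have h2 : p ^ (L + 1) ≤ p ^ n := pow_le_pow_right₀ (by linarith) (by omega)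
  have h3 : ((L + 1 : ℕ) : ℝ) ≤ 4 ^ L := by
    have : L + 1 ≤ 2 ^ L := Nat.lt_two_pow_self
    calc ((L + 1 : ℕ) : ℝ) ≤ 2 ^ L := by exact_mod_cast this
      _ ≤ 4 ^ L := by gcongr; norm_num
  have h4 : Real.exp (-(Q : ℝ)) ≤ δ := by
    have h5 : Real.log (1 / δ) ≤ Q := Nat.le_ceil _
    rw [one_div, Real.log_inv] at h5
    rw [← Real.le_log_iff_exp_le hδ]
    linarith
  have h6 : Real.exp (Q : ℝ) ≤ 4 ^ Q := by
    rw [← Real.exp_one_pow]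
    gcongr
    linarith [Real.exp_one_lt_d9]
  calc boxError (2 * n) * ((L + 1 : ℕ) : ℝ) * p ^ (L + 1)
      ≤ 2 * (5 / p ^ 2) ^ n * 4 ^ L * p ^ n := by gcongr
    _ = 2 * (5 / p) ^ n * 4 ^ L := by
        have : (5 / p ^ 2) ^ n * p ^ n = (5 / p) ^ n := by
          rw [← mul_pow]; congr 1; field_simp
        rw [← this]; ring
    _ ≤ 2 * (1 / 4) ^ n * 4 ^ L := by
        have : 5 / p ≤ 1 / 4 := by rw [div_le_div_iff₀ (by linarith) (by norm_num)]; linarith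
        gcongr
    _ = (2 * (1 / 4) ^ 10) * (4 ^ Q)⁻¹ := by
        rw [hn, pow_add, pow_add, one_div_pow, one_div_pow]; field_simp
    _ ≤ 1 * (Real.exp Q)⁻¹ := by
        gcongr
        norm_num
    _ ≤ δ := by rw [one_mul, ← Real.exp_neg]; exact h4

theorem bsfft_isAccurate {N : ℕ} {δ : ℝ} (hδ : 0 < δ) (x ξ : Fin N → ℝ)
    (hx : ∀ j, x j ∈ Set.Ico (0 : ℝ) 1) (hξ : ∀ k, ξ k ∈ Set.Ioc (0 : ℝ) N) :
    FourierMethod.IsAccurate bsfft N δ x ξ := by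
  intro c j
  have hval : (bsfft N δ x ξ c).val j = ∑ s, boxBasis (expansionDegree N δ) (Nat.clog 2 N)
      ⌊x j * 2 ^ Nat.clog 2 N⌋₊ 0 s (x j) * (butterfly N (Nat.clog 2 N) (expansionDegree N δ)
        ξ c (Nat.clog 2 N)).val ⌊x j * 2 ^ Nat.clog 2 N⌋₊ 0 s := by
    simp only [bsfft, bind, Flops.forEach, Flops.lincomb, Flops.sum, Flops.mul, mem_univ, if_true]
  rw [hval]
  have herr := expansionDegree_error_le (N := N) hδ
  set L := Nat.clog 2 N
  have hp : 1 ≤ expansionDegree N δ := by unfold expansionDegree; omega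
  set p := expansionDegree N δ
  have hp' : (1 : ℝ) ≤ p := by exact_mod_cast hp
  have hpos : 0 ≤ x j * 2 ^ L := mul_nonneg (hx j).1 (by positivity)
  have hi : ⌊x j * 2 ^ L⌋₊ < 2 ^ L := by
    rw [Nat.floor_lt hpos]
    push_cast
    nlinarith [(hx j).2, (by positivity : (0 : ℝ) < 2 ^ L)]
  have hmem : x j ∈ Set.Icc ((⌊x j * 2 ^ L⌋₊ : ℝ) / 2 ^ L) (((⌊x j * 2 ^ L⌋₊ : ℝ) + 1) / 2 ^ L) := by
    rw [Set.mem_Icc, div_le_iff₀ (by positivity), le_div_iff₀ (by positivity)]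
    exact ⟨Nat.floor_le hpos, (Nat.lt_floor_add_one _).le⟩
  have hbox : freqBox ξ L 0 = univ := by
    have hN : (N : ℝ) ≤ 2 ^ L := by exact_mod_cast Nat.le_pow_clog (b := 2) (by norm_num) N
    refine filter_true_of_mem fun k _ => ?_
    have := hξ k
    simp only [Nat.cast_zero, zero_mul, zero_add, one_mul]
    exact ⟨this.1, this.2.trans hN⟩
  have hb := butterfly_error (L := L) hp ξ c L le_rfl _ hi 0 (by positivity)
  have hκ := boxError_nonneg p
  -- On level L one frequency box holds all frequencies. The evaluation at x is one more
  -- interpolation step, hence the L + 1 in `herr`.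
  have key := norm_boxInterpolate_sub_le hp L _ 0 (freqBox ξ L 0) ξ c hmem
    (fun k hk => mem_Icc_of_mem_freqBox hk) _ (by positivity) hb
  rw [hbox] at key
  refine key.trans (mul_le_mul_of_nonneg_right (le_trans ?_ herr)
    (sum_nonneg fun _ _ => norm_nonneg _))
  have h1 : (1 : ℝ) ≤ (p : ℝ) ^ (L + 1) := one_le_pow₀ hp'
  push_cast
  rw [pow_succ] at h1 ⊢
  nlinarith

end

end DiskEval

namespace DiskEval

section

open Finset

/-! ### Operation counts -/

namespace Flops

theorem flops_bind {α β : Type} (c : Flops α) (g : α → Flops β) :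
    (c >>= g).flops = c.flops + (g c.val).flops := rfl

theorem flops_pure {α : Type} (a : α) : (pure a : Flops α).flops = 0 := rfl

theorem flops_lincomb {ι : Type} (s : Finset ι) (w v : ι → ℂ) :
    (lincomb s w v).flops = 2 * s.card := by
  simp [lincomb, sum, mul, mul_comm]

theorem flops_forEach_le {ι α : Type} [DecidableEq ι] [Zero α] {s : Finset ι} {c : ι → Flops α}
    {n K : ℕ} (hn : s.card ≤ n) (h : ∀ i ∈ s, (c i).flops ≤ K) : (forEach s c).flops ≤ n * K :=
  (sum_le_card_nsmul s _ K h).trans (by rw [smul_eq_mul]; exact Nat.mul_le_mul_right K hn)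

end Flops

theorem card_filter_fin_le {N : ℕ} (p : Fin N → Prop) [DecidablePred p] :
    (univ.filter p).card ≤ N := (card_filter_le _ _).trans (by simp)

/-- K bounds one transform. Each of the M - 1 bands calls one for its near field and one for each of
its q interpolation nodes. -/
theorem flops_unitDiskEval_le (F : FourierMethod) (N : ℕ) (ε : ℝ) (ξ : Fin N → ℝ)
    (z fhat : Fin N → ℂ) {K : ℕ}
    (hF : ∀ c, (F N (ε ^ 2 / 16) (fun j => Int.fract (Complex.arg (z j) / (2 * Real.pi))) ξ c).flops
      ≤ K) :
    (unitDiskEval F N ε ξ z fhat).flops ≤ K + N * (laplaceRank ε * 1) + (numBlocks N ε - 1) *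
      (K + N * (laplaceRank ε * (2 * laplaceRank ε)) + laplaceRank ε * K
        + N * (2 * laplaceRank ε + 1)) := by
  simp only [unitDiskEval, Flops.flops_bind, Flops.flops_pure]
  rw [add_zero, add_assoc]
  refine add_le_add (hF _) (add_le_add ?_ ?_)
  · exact Flops.flops_forEach_le (card_filter_fin_le _) fun k _ =>
      Flops.flops_forEach_le (by simp) fun r _ => le_rfl
  · refine Flops.flops_forEach_le (by simp) fun m _ => ?_
    simp only [Flops.flops_bind]
    rw [add_assoc, add_assoc]
    refine add_le_add (hF _) (add_le_add ?_ (add_le_add ?_ ?_))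
    · exact Flops.flops_forEach_le (card_filter_fin_le _) fun k _ =>
        Flops.flops_forEach_le (by simp) fun s _ => by rw [Flops.flops_lincomb]; simp
    · exact Flops.flops_forEach_le (by simp) fun s _ => hF _
    · refine Flops.flops_forEach_le (card_filter_fin_le _) fun j _ => ?_
      rw [Flops.flops_bind, Flops.flops_lincomb]
      simp [Flops.add]

theorem flops_fft (n : ℕ) : ∀ a : ℕ → ℂ, (fft n a).flops = 2 * n * 2 ^ n := by
  induction n with
  | zero => intro a; simp [fft, Flops.flops_pure]
  | succ n ih =>
    intro a
    have h : ∀ (e o : ℕ → ℂ) (n : ℕ), (Flops.forEach (range (2 ^ (n + 1))) fun l => do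
        let t ← Flops.mul (cis ((l : ℝ) / 2 ^ (n + 1))) (o (l % 2 ^ n))
        Flops.add (e (l % 2 ^ n)) t).flops = 2 ^ (n + 1) * 2 := by
      intro e o n
      simp [Flops.forEach, Flops.flops_bind, Flops.mul, Flops.add]
    simp only [fft, Flops.flops_bind]
    rw [ih, ih, h]
    ring

theorem card_Icc_ceil_floor_le (u : ℝ) (β : ℕ) :
    (Icc ⌈u - β⌉ ⌊u + β⌋).card ≤ 2 * β + 1 := by
  rw [Int.card_Icc]
  have h1 := Int.floor_le (u + β)
  have h2 := Int.le_ceil (u - β)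
  have h3 : ((⌊u + β⌋ - ⌈u - β⌉ : ℤ) : ℝ) ≤ ((2 * β : ℕ) : ℤ) := by push_cast; linarith
  have h4 : ⌊u + β⌋ - ⌈u - β⌉ ≤ ((2 * β : ℕ) : ℤ) := by exact_mod_cast h3
  omega

/-- The doubled frequencies are distinct integers, so a window meets few of them; this makes
spreading cheap. -/
theorem card_near_le {N : ℕ} (t : ℝ) (β : ℕ) :
    (univ.filter fun k : Fin N => |2 * ((k : ℝ) + 1) - t| ≤ (β : ℝ)).card ≤ 2 * β + 1 := by
  refine le_trans ?_ (card_Icc_ceil_floor_le t β)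
  refine card_le_card_of_injOn (fun k : Fin N => 2 * (((k : ℕ) : ℤ) + 1)) ?_ ?_
  · intro k hk
    have h := abs_le.mp (mem_filter.mp (mem_coe.mp hk)).2
    refine mem_coe.mpr (mem_Icc.mpr ⟨Int.ceil_le.mpr ?_, Int.le_floor.mpr ?_⟩) <;>
      push_cast <;> linarith
  · intro k _ k' _ h
    simp only at h
    exact Fin.ext (by omega)

theorem two_pow_clog_le {x : ℕ} (hx : 1 ≤ x) : 2 ^ Nat.clog 2 x ≤ 2 * x := by
  rcases hx.eq_or_lt with rfl | h
  · simp
  · have h1 := Nat.pow_pred_clog_lt_self (b := 2) (by norm_num) h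
    have h2 : 0 < Nat.clog 2 x := Nat.clog_pos (by norm_num) h
    rw [← Nat.succ_pred_eq_of_pos h2, pow_succ]
    omega

theorem flops_nnfft_le {N : ℕ} (hN : 1 ≤ N) (δ : ℝ) (x : Fin N → ℝ) (c : Fin N → ℂ) :
    (nnfft N δ x (fun k => (k : ℝ) + 1) c).flops ≤
      N * (52 + 68 * cutoff δ + 32 * (Nat.clog 2 N + 4)) := by
  by_cases h : N ≤ cutoff δ
  · have : nnfft N δ x (fun k => (k : ℝ) + 1) c = directFourier N x (fun k => (k : ℝ) + 1) c := by
      simp only [nnfft, if_pos h]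
    rw [this]
    refine (Flops.flops_forEach_le (n := N) (K := 2 * N) (by simp) fun j _ => ?_).trans ?_
    · rw [Flops.flops_lincomb]; simp
    · exact Nat.mul_le_mul_left _ (by omega)
  · obtain ⟨β, hβ⟩ : ∃ β, β = cutoff δ := ⟨_, rfl⟩
    obtain ⟨n, hn⟩ : ∃ n, n = Nat.clog 2 (4 * (N + β)) := ⟨_, rfl⟩
    have h' : ¬ N ≤ β := hβ ▸ h
    -- The direct branch is excluded, so β < N and the FFT length is linear in N; in that branch 2N²
    -- ≤ 2Nβ was enough.
    have hP : 2 ^ n ≤ 16 * N := by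
      rw [hn]
      exact (two_pow_clog_le (by omega)).trans (by omega)
    have hn' : n ≤ Nat.clog 2 N + 4 := by
      rw [hn, Nat.clog_le_iff_le_pow (by norm_num), pow_add]
      have := Nat.le_pow_clog (b := 2) (by norm_num) N
      omega
    have key : (nnfft N δ x (fun k => (k : ℝ) + 1) c).flops ≤
        N * 1 + (2 ^ n * (2 * (2 * β + 1) + 1) + (2 * n * 2 ^ n + N * (2 * (2 * β + 1) + 1))) := by
      simp only [nnfft, ← hβ, ← hn, if_neg h', Flops.flops_bind]
      refine add_le_add ?_ (add_le_add ?_ (add_le_add ?_ ?_))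
      · exact Flops.flops_forEach_le (by simp) fun k _ => le_rfl
      · refine Flops.flops_forEach_le (by simp) fun a _ => ?_
        rw [Flops.flops_bind, Flops.flops_lincomb]
        exact add_le_add (Nat.mul_le_mul_left 2 (card_near_le _ β)) le_rfl
      · rw [flops_fft]
      · refine Flops.flops_forEach_le (by simp) fun j _ => ?_
        rw [Flops.flops_bind, Flops.flops_lincomb]
        exact add_le_add (Nat.mul_le_mul_left 2 (card_Icc_ceil_floor_le _ β)) le_rfl
    rw [← hβ]
    refine key.trans ?_
    calc N * 1 + (2 ^ n * (2 * (2 * β + 1) + 1) + (2 * n * 2 ^ n + N * (2 * (2 * β + 1) + 1)))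
        ≤ N * 1 + ((16 * N) * (2 * (2 * β + 1) + 1) + (2 * (Nat.clog 2 N + 4) * (16 * N)
            + N * (2 * (2 * β + 1) + 1))) := by gcongr
      _ = _ := by ring

theorem card_unit_box_le {N : ℕ} (b : ℕ) :
    (univ.filter fun k : Fin N => (b : ℝ) < (k : ℝ) + 1 ∧ (k : ℝ) + 1 ≤ (b : ℝ) + 1).card ≤ 1 := by
  rw [card_le_one]
  intro k hk k' hk'
  have h1 := (mem_filter.mp hk).2
  have h2 := (mem_filter.mp hk').2
  have a1 : b < (k : ℕ) + 1 := by exact_mod_cast h1.1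
  have a2 : (k : ℕ) + 1 ≤ b + 1 := by exact_mod_cast h1.2
  have a3 : b < (k' : ℕ) + 1 := by exact_mod_cast h2.1
  have a4 : (k' : ℕ) + 1 ≤ b + 1 := by exact_mod_cast h2.2
  exact Fin.ext (by omega)

/-- Every level has 2^l · 2^{L-l} = 2^L pairs of boxes, with p values per pair. On level 0 each unit
box contains at most one frequency. -/
theorem flops_butterfly_le (N L p : ℕ) (c : Fin N → ℂ) (l : ℕ) : l ≤ L →
    (butterfly N L p (fun k => (k : ℝ) + 1) c l).flops
      ≤ 2 ^ L * (p * 2) + l * (2 ^ L * (p * (4 * p + 1))) := by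
  induction l with
  | zero =>
    intro _
    simp only [butterfly]
    refine (Flops.flops_forEach_le (n := 1) (K := 2 ^ L * (p * 2)) (by simp) fun i _ =>
      Flops.flops_forEach_le (by simp) fun b _ => Flops.flops_forEach_le (by simp) fun r _ => ?_).trans
      (by simp)
    rw [Flops.flops_lincomb]
    exact Nat.mul_le_mul_left 2 (card_unit_box_le b)
  | succ l ih =>
    intro hl
    simp only [butterfly, Flops.flops_bind]
    have hpow : 2 ^ (l + 1) * (2 ^ (L - (l + 1)) * (p * (4 * p + 1))) = 2 ^ L * (p * (4 * p + 1)) := by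
      rw [← mul_assoc, ← pow_add, Nat.add_sub_cancel' hl]
    rw [add_mul, one_mul, ← add_assoc, ← hpow]
    refine add_le_add (by rw [hpow]; exact ih (by omega)) ?_
    refine Flops.flops_forEach_le (by simp) fun i _ =>
      Flops.flops_forEach_le (by simp) fun b _ => Flops.flops_forEach_le (by simp) fun r _ => ?_
    simp only [Flops.flops_bind, Flops.flops_lincomb, card_univ, Fintype.card_fin, Flops.add]
    omega

/-- For N ≥ 2 there is at least one level, so the initial and final stages are absorbed into L p².
-/
theorem flops_bsfft_le {N : ℕ} (hN : 2 ≤ N) (δ : ℝ) (x : Fin N → ℝ) (c : Fin N → ℂ) :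
    (bsfft N δ x (fun k => (k : ℝ) + 1) c).flops ≤
      N * (16 * Nat.clog 2 N * expansionDegree N δ ^ 2) := by
  have hL : 1 ≤ Nat.clog 2 N := Nat.clog_pos (by norm_num) hN
  have hp : 1 ≤ expansionDegree N δ := by unfold expansionDegree; omega
  have h2 : 2 ^ Nat.clog 2 N ≤ 2 * N := two_pow_clog_le (by omega)
  simp only [bsfft, Flops.flops_bind]
  set L := Nat.clog 2 N
  set p := expansionDegree N δ
  have h1 := flops_butterfly_le N L p c L le_rfl
  have h3 := Flops.flops_forEach_le (α := ℂ) (s := (univ : Finset (Fin N))) (n := N) (K := 2 * p)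
    (c := fun j => Flops.lincomb univ (fun s => boxBasis p L ⌊x j * 2 ^ L⌋₊ 0 s (x j))
      ((butterfly N L p (fun k => (k : ℝ) + 1) c L).val ⌊x j * 2 ^ L⌋₊ 0)) (by simp)
    fun j _ => by rw [Flops.flops_lincomb]; simp
  refine (add_le_add h1 h3).trans ?_
  have hLp : p ≤ L * p ^ 2 := by
    calc p = 1 * (p * 1) := by ring
      _ ≤ L * (p * p) := by gcongr
      _ = _ := by ring
  have hLp2 : L * p ≤ L * p ^ 2 := Nat.mul_le_mul_left L (by nlinarith)
  calc 2 ^ L * (p * 2) + L * (2 ^ L * (p * (4 * p + 1))) + N * (2 * p)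
      ≤ 2 * N * (p * 2) + L * (2 * N * (p * (4 * p + 1))) + N * (2 * p) := by gcongr
    _ = N * (6 * p + 2 * (L * p) + 8 * (L * p ^ 2)) := by ring
    _ ≤ N * (16 * L * p ^ 2) := by
      refine Nat.mul_le_mul_left N ?_
      nlinarith

/-! ### Parameter sizes -/

theorem half_le_log_two : 1 / 2 ≤ Real.log 2 := by linarith [Real.log_two_gt_d9]

theorem logb_two_le {t : ℝ} (ht : 1 ≤ t) : Real.logb 2 t ≤ 2 * Real.log t := by
  have h := half_le_log_two
  have h0 := Real.log_nonneg ht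
  rw [Real.logb, div_le_iff₀ (by linarith)]
  nlinarith

theorem clog_two_le {N : ℕ} (hN : 1 ≤ N) : (Nat.clog 2 N : ℝ) ≤ 1 + 2 * Real.log N := by
  have hN' : (1 : ℝ) ≤ N := by exact_mod_cast hN
  have h1 : (2 : ℝ) ^ Nat.clog 2 N ≤ 2 * N := by exact_mod_cast two_pow_clog_le hN
  have h2 := Real.log_le_log (by positivity) h1
  rw [Real.log_pow, Real.log_mul (by norm_num) (by linarith)] at h2
  have h3 := half_le_log_two
  have h4 := Real.log_nonneg hN'
  by_contra hcon
  push Not at hcon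
  nlinarith

theorem ceil_log_tolerance_le {ε : ℝ} (h0 : 0 < ε) (h1 : ε < 1) :
    (⌈Real.log (1 / (ε ^ 2 / 16))⌉₊ : ℝ) ≤ 4 + 2 * Real.log (1 / ε) := by
  have hl : 0 < Real.log (1 / ε) := Real.log_pos (by rw [lt_div_iff₀ h0]; linarith)
  have e : Real.log (1 / (ε ^ 2 / 16)) = 4 * Real.log 2 + 2 * Real.log (1 / ε) := by
    rw [show 1 / (ε ^ 2 / 16) = 2 ^ 4 * (1 / ε) ^ 2 by field_simp; norm_num,
      Real.log_mul (by norm_num) (by positivity), Real.log_pow, Real.log_pow]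
    norm_num
  have h2 := Real.log_two_lt_d9
  have h3 := half_le_log_two
  have := Nat.ceil_lt_add_one (a := Real.log (1 / (ε ^ 2 / 16))) (by rw [e]; linarith)
  rw [e] at this ⊢
  linarith

theorem numBlocks_sub_one_le {N : ℕ} (hN : 1 ≤ N) {ε : ℝ} (h0 : 0 < ε) (h1 : ε < 1) :
    ((numBlocks N ε - 1 : ℕ) : ℝ) ≤ 4 * Real.log (N / ε) + 1 := by
  have hN' : (1 : ℝ) ≤ N := by exact_mod_cast hN
  have hl : 0 < Real.log (1 / ε) := Real.log_pos (by rw [lt_div_iff₀ h0]; linarith)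
  have hH : Real.log (N / ε) = Real.log N + Real.log (1 / ε) := by
    rw [← Real.log_mul (by linarith) (by positivity)]; congr 1; ring
  have hG := Real.log_nonneg hN'
  rcases le_or_gt (⌈Real.logb 2 ((N : ℝ) * Real.log (1 / ε) / ε)⌉) 0 with h | h
  · have : numBlocks N ε - 1 = 0 := by unfold numBlocks; omega
    rw [this, hH]
    simp only [Nat.cast_zero]
    linarith
  · have hM : ((numBlocks N ε - 1 : ℕ) : ℤ) = ⌈Real.logb 2 ((N : ℝ) * Real.log (1 / ε) / ε)⌉ := by
      unfold numBlocks; omega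
    have hM' : ((numBlocks N ε - 1 : ℕ) : ℝ)
        = (⌈Real.logb 2 ((N : ℝ) * Real.log (1 / ε) / ε)⌉ : ℝ) := by exact_mod_cast hM
    rw [hM']
    have h2 := (Int.ceil_lt_add_one (Real.logb 2 ((N : ℝ) * Real.log (1 / ε) / ε))).le
    have hpos : 0 < Real.logb 2 ((N : ℝ) * Real.log (1 / ε) / ε) := Int.ceil_pos.mp h
    have h3 : 1 ≤ (N : ℝ) * Real.log (1 / ε) / ε := by
      by_contra hcon
      push Not at hcon
      exact absurd hpos (not_lt.mpr (Real.logb_nonpos (by norm_num) (by positivity) hcon.le))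
    have h4 := logb_two_le h3
    have h5 : Real.log ((N : ℝ) * Real.log (1 / ε) / ε)
        = Real.log (N / ε) + Real.log (Real.log (1 / ε)) := by
      rw [← Real.log_mul (by positivity) hl.ne']; congr 1; ring
    have h6 : Real.log (Real.log (1 / ε)) ≤ Real.log (1 / ε) - 1 := Real.log_le_sub_one_of_pos hl
    linarith

theorem laplaceRank_le {ε : ℝ} (h0 : 0 < ε) (h1 : ε < 1) :
    (laplaceRank ε : ℝ) ≤ 3 / 2 + Real.log (1 / ε) := by
  have hl : 0 ≤ Real.log (1 / ε) := Real.log_nonneg (by rw [le_div_iff₀ h0]; linarith)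
  have h4 : Real.log 4 = 2 * Real.log 2 := by
    rw [show (4 : ℝ) = 2 ^ 2 by norm_num, Real.log_pow]; norm_num
  have h2 : Real.logb 4 (1 / ε) ≤ Real.log (1 / ε) := by
    rw [Real.logb, h4]
    exact div_le_self hl (by linarith [half_le_log_two])
  have h3 : 0 ≤ Real.logb 4 (1 / ε) :=
    Real.logb_nonneg (by norm_num) (by rw [le_div_iff₀ h0]; linarith)
  have := Nat.ceil_lt_add_one (a := 1 / 2 + Real.logb 4 (1 / ε)) (by linarith)
  unfold laplaceRank
  linarith

/-- The sizes of all parameters in terms of `X = C * log (1 / ε)` and `Y = C * log (N / ε)`, where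
`C` depends only on the upper bound `ε₀` of `ε`. -/
theorem exists_parameter_bound {ε₀ : ℝ} (hε₀ : 0 < ε₀) (hε₁ : ε₀ < 1) :
    ∃ C : ℝ, 0 < C ∧ ∀ (N : ℕ) (ε : ℝ), 1 ≤ N → 0 < ε → ε ≤ ε₀ →
      1 ≤ C * Real.log (1 / ε) ∧ C * Real.log (1 / ε) ≤ C * Real.log (N / ε) ∧
      (laplaceRank ε : ℝ) ≤ C * Real.log (1 / ε) ∧
      ((numBlocks N ε - 1 : ℕ) : ℝ) ≤ C * Real.log (N / ε) ∧
      (cutoff (ε ^ 2 / 16) : ℝ) ≤ C * Real.log (N / ε) ∧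
      (Nat.clog 2 N : ℝ) + 4 ≤ C * Real.log (N / ε) ∧
      (expansionDegree N (ε ^ 2 / 16) : ℝ) ≤ C * Real.log (N / ε) := by
  have hl₀ : 0 < Real.log (1 / ε₀) := Real.log_pos (by rw [lt_div_iff₀ hε₀]; linarith)
  -- All parameters are at most 30 + 8t with t the relevant logarithm; 30 = 2 + 8 + 20 occurs for
  -- the expansion degree. As t ≥ log(1/ε₀) > 0, the additive constant becomes a multiple of t.
  refine ⟨30 / Real.log (1 / ε₀) + 8, by positivity, ?_⟩
  intro N ε hN h0 hε
  have h1 : ε < 1 := by linarith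
  have hl : Real.log (1 / ε₀) ≤ Real.log (1 / ε) :=
    Real.log_le_log (by positivity) (one_div_le_one_div_of_le h0 hε)
  have hN' : (1 : ℝ) ≤ N := by exact_mod_cast hN
  have hH : Real.log (N / ε) = Real.log N + Real.log (1 / ε) := by
    rw [← Real.log_mul (by linarith) (by positivity)]; congr 1; ring
  have hG := Real.log_nonneg hN'
  have a1 := laplaceRank_le h0 h1
  have a2 := numBlocks_sub_one_le hN h0 h1
  have a3 := ceil_log_tolerance_le h0 h1
  have a4 := clog_two_le hN
  have a5 : (cutoff (ε ^ 2 / 16) : ℝ) = ⌈Real.log (1 / (ε ^ 2 / 16))⌉₊ + 10 := by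
    unfold cutoff; push_cast; ring
  have a6 : (expansionDegree N (ε ^ 2 / 16) : ℝ)
      = 2 * Nat.clog 2 N + 2 * ⌈Real.log (1 / (ε ^ 2 / 16))⌉₊ + 20 := by
    unfold expansionDegree; push_cast; ring
  have key : ∀ t, Real.log (1 / ε₀) ≤ t →
      30 + 8 * t ≤ (30 / Real.log (1 / ε₀) + 8) * t := by
    intro t ht
    have : 30 ≤ 30 / Real.log (1 / ε₀) * t := by
      rw [div_mul_eq_mul_div, le_div_iff₀ hl₀]; linarith
    linarith
  have k1 := key _ hl
  have k2 := key (Real.log (N / ε)) (by linarith)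
  refine ⟨by linarith, mul_le_mul_of_nonneg_left (by linarith) (by positivity), by linarith,
    by linarith, by linarith, by linarith, by linarith⟩

/-! ### Total operation counts -/

theorem flops_polyEval_nnfft_le {ε₀ : ℝ} (hε₀ : 0 < ε₀) (hε₁ : ε₀ < 1) :
    ∃ C : ℝ, ∀ (N : ℕ) (ε : ℝ) (z fhat : Fin N → ℂ), 1 ≤ N → 0 < ε → ε ≤ ε₀ →
      ((polyEval nnfft N ε z fhat).flops : ℝ) ≤
        C * ((N : ℝ) * Real.log (1 / ε) * Real.log ((N : ℝ) / ε) ^ 2) := by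
  obtain ⟨C, hC, h⟩ := exists_parameter_bound hε₀ hε₁
  refine ⟨462 * C ^ 3, ?_⟩
  intro N ε z fhat hN h0 hε
  obtain ⟨hX, hXY, hq, hM, hβ, hL, -⟩ := h N ε hN h0 hε
  set X := C * Real.log (1 / ε) with hXdef
  set Y := C * Real.log (N / ε) with hYdef
  have hflops := flops_unitDiskEval_le nnfft N ε (fun k => (k : ℝ) + 1) z fhat
    fun c => flops_nnfft_le hN _ _ c
  set K := N * (52 + 68 * cutoff (ε ^ 2 / 16) + 32 * (Nat.clog 2 N + 4)) with hK
  have hK' : (K : ℝ) ≤ N * (152 * Y) := by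
    rw [hK]; push_cast
    refine mul_le_mul_of_nonneg_left ?_ (by positivity)
    linarith
  have hflops' := (Nat.cast_le (α := ℝ)).mpr hflops
  rw [polyEval]
  refine hflops'.trans ?_
  push_cast
  set q : ℝ := (laplaceRank ε : ℝ)
  have hq0 : 0 ≤ q := Nat.cast_nonneg _
  have hN0 : (0 : ℝ) ≤ N := Nat.cast_nonneg _
  have hY1 : 1 ≤ Y := hX.trans hXY
  calc (K : ℝ) + N * (q * 1) + ((numBlocks N ε - 1 : ℕ) : ℝ) *
        (K + N * (q * (2 * q)) + q * K + N * (2 * q + 1))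
      ≤ N * (152 * Y) + N * (X * 1) + Y * (N * (152 * Y) + N * (X * (2 * X)) + X * (N * (152 * Y))
          + N * (2 * X + X)) := by
        gcongr
    _ = N * (152 * (1 * Y * 1) + X * 1 * 1 + 152 * (1 * Y * Y) + 2 * (X * X * Y)
          + 152 * (X * Y * Y) + 3 * (X * Y * 1)) := by ring
    -- Since 1 ≤ X ≤ Y, every monomial is at most X Y².
    _ ≤ N * (152 * (X * Y * Y) + X * Y * Y + 152 * (X * Y * Y) + 2 * (X * Y * Y)
          + 152 * (X * Y * Y) + 3 * (X * Y * Y)) := by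
        gcongr
    _ = 462 * C ^ 3 * ((N : ℝ) * Real.log (1 / ε) * Real.log ((N : ℝ) / ε) ^ 2) := by
        rw [hXdef, hYdef]; ring

theorem flops_polyEval_bsfft_le {ε₀ : ℝ} (hε₀ : 0 < ε₀) (hε₁ : ε₀ < 1) :
    ∃ C : ℝ, ∀ (N : ℕ) (ε : ℝ) (z fhat : Fin N → ℂ), 2 ≤ N → 0 < ε → ε ≤ ε₀ →
      ((polyEval bsfft N ε z fhat).flops : ℝ) ≤
        C * ((N : ℝ) * Real.log (N : ℝ) * Real.log (1 / ε) * Real.log ((N : ℝ) / ε) ^ 3) := by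
  obtain ⟨C, hC, h⟩ := exists_parameter_bound hε₀ hε₁
  refine ⟨204 * C ^ 4, ?_⟩
  intro N ε z fhat hN h0 hε
  obtain ⟨hX, hXY, hq, hM, -, -, hp⟩ := h N ε (by omega) h0 hε
  set X := C * Real.log (1 / ε) with hXdef
  set Y := C * Real.log (N / ε) with hYdef
  have hN2 : (2 : ℝ) ≤ N := by exact_mod_cast hN
  set G := Real.log N with hG
  -- N ≥ 2 keeps log N away from 0, so terms not caused by a transform can be given the factor log N
  -- too.
  have hG1 : 1 ≤ 2 * G := by
    have := Real.log_le_log (by norm_num) hN2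
    linarith [half_le_log_two]
  have hL : (Nat.clog 2 N : ℝ) ≤ 4 * G := by
    have := clog_two_le (N := N) (by omega)
    linarith
  have hflops := flops_unitDiskEval_le bsfft N ε (fun k => (k : ℝ) + 1) z fhat
    fun c => flops_bsfft_le hN _ _ c
  have hY1 : 1 ≤ Y := hX.trans hXY
  set K := N * (16 * Nat.clog 2 N * expansionDegree N (ε ^ 2 / 16) ^ 2) with hK
  have hK' : (K : ℝ) ≤ N * (16 * (4 * G) * Y ^ 2) := by
    rw [hK]; push_cast
    gcongr
  have hflops' := (Nat.cast_le (α := ℝ)).mpr hflops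
  rw [polyEval]
  refine hflops'.trans ?_
  push_cast
  set q : ℝ := (laplaceRank ε : ℝ)
  have hq0 : 0 ≤ q := Nat.cast_nonneg _
  have hN0 : (0 : ℝ) ≤ N := Nat.cast_nonneg _
  calc (K : ℝ) + N * (q * 1) + ((numBlocks N ε - 1 : ℕ) : ℝ) *
        (K + N * (q * (2 * q)) + q * K + N * (2 * q + 1))
      ≤ N * (16 * (4 * G) * Y ^ 2) + N * (X * (2 * G)) + Y * (N * (16 * (4 * G) * Y ^ 2)
          + N * (X * (2 * X)) * (2 * G) + X * (N * (16 * (4 * G) * Y ^ 2))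
          + N * (2 * X + X) * (2 * G)) := by
        have e1 : N * (q * (2 * q)) ≤ N * (X * (2 * X)) * (2 * G) := by
          refine le_trans (by gcongr) (le_mul_of_one_le_right (by positivity) hG1)
        have e2 : N * (2 * q + 1) ≤ N * (2 * X + X) * (2 * G) := by
          refine le_trans (by gcongr) (le_mul_of_one_le_right (by positivity) hG1)
        gcongr
    _ = N * G * (64 * (1 * Y * Y * 1) + 2 * (X * 1 * 1 * 1) + 64 * (1 * Y * Y * Y)
          + 4 * (X * X * Y * 1) + 64 * (X * Y * Y * Y) + 6 * (X * Y * 1 * 1)) := by ring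
    _ ≤ N * G * (64 * (X * Y * Y * Y) + 2 * (X * Y * Y * Y) + 64 * (X * Y * Y * Y)
          + 4 * (X * Y * Y * Y) + 64 * (X * Y * Y * Y) + 6 * (X * Y * Y * Y)) := by
        gcongr
    _ = 204 * C ^ 4 * ((N : ℝ) * G * Real.log (1 / ε) * Real.log ((N : ℝ) / ε) ^ 3) := by
        rw [hXdef, hYdef]; ring

end

end DiskEval

namespace DiskEval

/-! ### Assembly of the main theorem -/

theorem fract_mem_Ico (t : ℝ) : Int.fract t ∈ Set.Ico (0 : ℝ) 1 :=
  ⟨Int.fract_nonneg t, Int.fract_lt_one t⟩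

theorem natCast_add_one_mem_Ioc {N : ℕ} (k : Fin N) : ((k : ℕ) : ℝ) + 1 ∈ Set.Ioc (0 : ℝ) N :=
  ⟨by positivity, by exact_mod_cast k.2⟩

end DiskEval

theorem mainTheorem1 :
    -- accuracy
    (∀ (N : ℕ) (ε : ℝ) (z fhat : Fin N → ℂ),
      1 ≤ N → 0 < ε → ε < 1 → (∀ j, ‖z j‖ ≤ 1) →
        ‖(DiskEval.powerMatrix N z).mulVec fhat
            - (DiskEval.polyEval DiskEval.nnfft N ε z fhat).val‖ ≤ ε * ∑ k, ‖fhat k‖ ∧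
        ‖(DiskEval.powerMatrix N z).mulVec fhat
            - (DiskEval.polyEval DiskEval.bsfft N ε z fhat).val‖ ≤ ε * ∑ k, ‖fhat k‖) ∧
    -- operation counts
    (∀ ε₀ : ℝ, 0 < ε₀ → ε₀ < 1 →
      (∃ C : ℝ, ∀ (N : ℕ) (ε : ℝ) (z fhat : Fin N → ℂ),
        1 ≤ N → 0 < ε → ε ≤ ε₀ → (∀ j, ‖z j‖ ≤ 1) →
          ((DiskEval.polyEval DiskEval.nnfft N ε z fhat).flops : ℝ) ≤
            C * ((N : ℝ) * Real.log (1 / ε) * Real.log ((N : ℝ) / ε) ^ 2)) ∧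
      (∃ C : ℝ, ∀ (N : ℕ) (ε : ℝ) (z fhat : Fin N → ℂ),
        2 ≤ N → 0 < ε → ε ≤ ε₀ → (∀ j, ‖z j‖ ≤ 1) →
          ((DiskEval.polyEval DiskEval.bsfft N ε z fhat).flops : ℝ) ≤
            C * ((N : ℝ) * Real.log (N : ℝ) * Real.log (1 / ε)
              * Real.log ((N : ℝ) / ε) ^ 3))) := by
  refine ⟨fun N ε z fhat hN h0 h1 hz => ⟨?_, ?_⟩, fun ε₀ h0 h1 => ⟨?_, ?_⟩⟩
  · exact DiskEval.norm_eval_sub_le hN h0 h1 z fhat hz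
      (DiskEval.nnfft_isAccurate (by positivity) _ _ (fun j => DiskEval.fract_mem_Ico _)
        fun k => Set.Ioc_subset_Icc_self (DiskEval.natCast_add_one_mem_Ioc k))
  · exact DiskEval.norm_eval_sub_le hN h0 h1 z fhat hz
      (DiskEval.bsfft_isAccurate (by positivity) _ _ (fun j => DiskEval.fract_mem_Ico _)
        DiskEval.natCast_add_one_mem_Ioc)
  · obtain ⟨C, hC⟩ := DiskEval.flops_polyEval_nnfft_le h0 h1
    exact ⟨C, fun N ε z fhat hN hε hεε₀ _ => hC N ε z fhat hN hε hεε₀⟩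
  · obtain ⟨C, hC⟩ := DiskEval.flops_polyEval_bsfft_le h0 h1
    exact ⟨C, fun N ε z fhat hN hε hεε₀ _ => hC N ε z fhat hN hε hεε₀⟩
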